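/- Let $T>0$, $L>0$, $0<\underline a\le\overline a$, $0<\alpha\le 1$, $0<\gamma\le 1$, $A,H\ge 0$. Consider either the periodic setting, $D=[0,L)$, in which all functions of $x$ are $L$-periodic on $\mathbb R$, or the whole-line setting, $D=\mathbb R$, in which the initial data vanish outside $[-L,L]$. Then there is a constant $C\ge 0$ depending only on the setting and on $\underline a,\overline a,\alpha,\gamma,A,H,L,T$ such that the following holds. Let $a:\mathbb R\to\mathbb R$ satisfy $\underline a\le a\le\overline a$ and $|a(x)-a(y)|\le A|x-y|^{\alpha}$ for all $x,y$, and let $w_0:\mathbb R\to\mathbb R$ satisfy $|w_0(x)-w_0(y)|\le H|x-y|^{\gamma}$ for all $x,y$. Let $\omega\in C_c^\infty(\mathbb R)$ be even with $0\le\omega\le1$, $\omega(x)=0$ for $|x|\ge1$ and $\int\omega=1$, put $\omega_\delta(x)=\delta^{-1}\omega(x/\delta)$, and for $\delta>0$ let $w^\delta$ be the classical solution on $[0,T]\times\mathbb R$ of $$\partial_t\Bigl(\frac{w^\delta}{a*\omega_\delta}\Bigr)+\partial_x w^\delta=0,\qquad w^\delta(0,\cdot)=w_0*\omega_\delta .$$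 Then the limit $w=\lim_{\delta\to0^+}w^\delta$ exists (pointwise on $[0,T]\times\mathbb R$), and it is a weak solution of $\partial_t(w/a)+\partial_xw=0$, $w(0,\cdot)=w_0$: it is Hölder continuous on $[0,T]\times\mathbb R$, and for every $\varphi\in C_c^\infty(\mathbb R^2)$ and $t\in(0,T]$, $$\int_0^t\!\!\int_{\mathbb R}\Bigl(\frac{w}{a}\,\partial_t\varphi+w\,\partial_x\varphi\Bigr)dx\,ds+\int_{\mathbb R}\frac{w_0}{a}\,\varphi(0,x)\,dx=\int_{\mathbb R}\frac{w(t,x)}{a(x)}\,\varphi(t,x)\,dx .$$ Let $\theta>0$ with $\theta\,\overline a\le1$. For a mesh size $\Delta x>0$ (with $L/\Delta x\in\mathbb N$ in the periodic setting) let $\Delta t=\theta\Delta x$, and define $w_j^n$ ($j\in\mathbb Z$, $n\ge0$) by the upwind scheme $$\frac{w_j^{n+1}-w_j^n}{a_j\,\Delta t}=-\frac{w_j^n-w_{j-1}^n}{\Delta x},\qquad a_j=\frac1{\Delta x}\int_{(j-1)\Delta x}^{j\Delta x}a\,dx,\qquad w_j^0=\frac1{\Delta x}\int_{(j-1)\Delta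 x}^{j\Delta x}w_0\,dx,$$ and let $w_{\Delta x}(t,x)=w_j^n$ for $(t,x)\in[n\Delta t,(n+1)\Delta t)\times[(j-1)\Delta x,j\Delta x)$. Then for every $0<\tau<T$ and every such $\Delta x$, $$\|(w-w_{\Delta x})(\tau,\cdot)\|_{L^2(D)}\le C\,\Delta x^{\frac{\gamma\alpha}{\gamma\alpha+2-\gamma}}+C\,\|w_0-w_{\Delta x}(0,\cdot)\|_{L^2(D)},$$ and $\|(w-w_{\Delta x})(\tau,\cdot)\|_{L^2(D)}\to0$ as $\Delta x\to0$ with $\theta$ fixed. -/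

import Mathlib

open Set Filter Topology MeasureTheory
open scoped Convolution ContDiff NNReal ENNReal

noncomputable section

/-- A smooth even kernel `ρ` with `0 ≤ ρ ≤ 1`, vanishing outside `(-1, 1)`, of integral one. -/
structure IsMollifier (ρ : ℝ → ℝ) : Prop where
  smooth : ContDiff ℝ ∞ ρ
  even : ∀ x, ρ (-x) = ρ x
  nonneg : ∀ x, 0 ≤ ρ x
  le_one : ∀ x, ρ x ≤ 1
  eq_zero : ∀ x, 1 ≤ |x| → ρ x = 0
  integral_eq_one : ∫ x, ρ x = 1

/-- The rescaled kernel `ρ_δ(x) = δ⁻¹ ρ(x / δ)`. -/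
def scaledKernel (ρ : ℝ → ℝ) (δ : ℝ) (x : ℝ) : ℝ := 1 / δ * ρ (x / δ)

/-- The regularization `f ∗ ρ_δ`. -/
def mollify (ρ : ℝ → ℝ) (δ : ℝ) (f : ℝ → ℝ) : ℝ → ℝ :=
  f ⋆[ContinuousLinearMap.mul ℝ ℝ, volume] scaledKernel ρ δ

/-- The two spatial settings: a finite interval with periodic boundary conditions, and the
whole line with compactly supported initial data. In both, the coefficient and the data are
functions on `ℝ`; in the periodic setting they are the periodic extensions. -/
inductive SpatialDomain where
  | periodic
  | line

/-- The domain `D`: one period `[0, L)`, or the whole line. -/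
def SpatialDomain.toSet (D : SpatialDomain) (L : ℝ) : Set ℝ :=
  match D with
  | .periodic => Ico 0 L
  | .line => univ

/-- Periodic setting: `a` and `w₀` are `L`-periodic. Whole line: `w₀` vanishes off `[-L, L]`. -/
def SpatialDomain.Admissible (D : SpatialDomain) (L : ℝ) (a w₀ : ℝ → ℝ) : Prop :=
  match D with
  | .periodic => Function.Periodic a L ∧ Function.Periodic w₀ L
  | .line => ∀ x, L < |x| → w₀ x = 0

/-- The mesh sizes: in the periodic setting the period consists of a whole number of cells. -/
def SpatialDomain.meshSizes (D : SpatialDomain) (L : ℝ) : Set ℝ :=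
  match D with
  | .periodic => {h | 0 < h ∧ ∃ N : ℕ, (N : ℝ) * h = L}
  | .line => {h | 0 < h}

/-- `v` is the classical solution on `[0, T] × ℝ` of
`∂ₜ (v / a^δ) + ∂ₓ v = 0`, `v(0, ·) = w₀ ∗ ρ_δ`, where `a^δ = a ∗ ρ_δ`.
For periodic `a` and `w₀` it is automatically periodic in space. -/
structure IsRegularizedSolution (ρ : ℝ → ℝ) (δ : ℝ) (a w₀ : ℝ → ℝ) (T : ℝ)
    (v : ℝ → ℝ → ℝ) : Prop where
  continuousOn : ContinuousOn (fun p : ℝ × ℝ => v p.1 p.2) (Icc 0 T ×ˢ univ)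
  contDiffOn : ContDiffOn ℝ 1 (fun p : ℝ × ℝ => v p.1 p.2) (Ioo 0 T ×ˢ univ)
  equation : ∀ t ∈ Ioo 0 T, ∀ x,
    deriv (fun s => v s x / mollify ρ δ a x) t + deriv (fun y => v t y) x = 0
  initial : ∀ x, v 0 x = mollify ρ δ w₀ x

/-- `w = lim_{δ → 0⁺} w^δ` on `[0, T] × ℝ`, where `w^δ` solves the regularized problem. -/
def IsRegularizationLimit (ρ : ℝ → ℝ) (a w₀ : ℝ → ℝ) (T : ℝ) (w : ℝ → ℝ → ℝ) : Prop :=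
  ∃ v : ℝ → ℝ → ℝ → ℝ,
    (∀ δ > 0, IsRegularizedSolution ρ δ a w₀ T (v δ)) ∧
    ∀ t ∈ Icc 0 T, ∀ x, Tendsto (fun δ => v δ t x) (𝓝[>] 0) (𝓝 (w t x))

/-- Weak solution of `∂ₜ (w / a) + ∂ₓ w = 0`, `w(0, ·) = w₀` on `[0, T] × ℝ`: a Hölder continuous
function which satisfies the equation and the initial condition tested against smooth
compactly supported functions of `(t, x)`. -/
def IsWeakSolution (a w₀ : ℝ → ℝ) (T : ℝ) (w : ℝ → ℝ → ℝ) : Prop :=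
  (∃ β K : ℝ≥0, 0 < β ∧ HolderOnWith K β (fun p : ℝ × ℝ => w p.1 p.2) (Icc 0 T ×ˢ univ)) ∧
  ∀ φ : ℝ × ℝ → ℝ, ContDiff ℝ ∞ φ → HasCompactSupport φ → ∀ t ∈ Ioc 0 T,
    (∫ s in (0 : ℝ)..t, ∫ x, (w s x / a x * deriv (fun r => φ (r, x)) s
        + w s x * deriv (fun y => φ (s, y)) x))
      + ∫ x, w₀ x / a x * φ (0, x)
    = ∫ x, w t x / a x * φ (t, x)

/-- Average of `f` over the cell `[x_{j-1/2}, x_{j+1/2}) = [(j-1)Δx, jΔx)`. -/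
def cellAverage (f : ℝ → ℝ) (Δx : ℝ) (j : ℤ) : ℝ :=
  1 / Δx * ∫ x in (((j : ℝ) - 1) * Δx)..((j : ℝ) * Δx), f x

/-- The backward difference quotient `D⁻ₓ σ_j = (σ_j - σ_{j-1}) / Δx`. -/
def backwardDiff (Δx : ℝ) (σ : ℤ → ℝ) (j : ℤ) : ℝ := (σ j - σ (j - 1)) / Δx

/-- The upwind scheme `((w_j^{n+1} - w_j^n) / Δt) / a_j = - D⁻ₓ w_j^n` on the cells `j ∈ ℤ`,
started from the cell averages of `w₀`, solved for `w_j^{n+1}`. -/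
def upwind (a w₀ : ℝ → ℝ) (Δt Δx : ℝ) : ℕ → ℤ → ℝ
  | 0, j => cellAverage w₀ Δx j
  | n + 1, j => upwind a w₀ Δt Δx n j
      - Δt * (cellAverage a Δx j * backwardDiff Δx (upwind a w₀ Δt Δx n) j)

/-- The piecewise constant function equal to `w_j^n` on
`[nΔt, (n+1)Δt) × [(j-1)Δx, jΔx)`. -/
def upwindApprox (a w₀ : ℝ → ℝ) (Δt Δx : ℝ) (t x : ℝ) : ℝ :=
  upwind a w₀ Δt Δx ⌊t / Δt⌋₊ (⌊x / Δx⌋ + 1)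

end

/-! The regularized problem is solved by characteristics. Travel time from the origin turns them
into unit-speed translations, so the solution is the initial datum evaluated at the foot. Feet
depend continuously on the speed in the uniform norm, hence the regularized solutions converge to
`w₀ (charFoot a t x)`; `IsRegularizationLimit.eq_charFoot` identifies every limit with this formula,
and `IsSpeed.weak_formulation` verifies the weak equation in Lagrangian coordinates.

Under the CFL condition an upwind step is a convex combination, the expectation over one step of a
random walk that stays in cell `j` or moves to `j - 1`. Measured by the discrete travel time `g`,
whose increments are `Δx / a_j`, the walk has mean displacement exactly `Δt` in every cell, and its
variance up to time `T` is at most `T Δx / aLow`. Thus quadratic bounds in `g` propagate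
(`abs_upwind_sub_le_quadratic`). Hölder data are dominated by such a bound at any scale `ε`, and `g`
agrees with the true travel time up to `O(Δx ^ α)`. With `ε` at least `Δx ^ α` and `√Δx` this gives
a uniform error `O(ε ^ γ)` (`abs_upwind_sub_charFoot_le`); the stated rate is one admissible choice
of `ε`.

On the line a Chebyshev-type use of the same quadratic bound gives decay away from the support. The
pointwise error then carries the square-integrable weight `1 / (1 + |x|)`, and the `L²` estimate
follows. -/

/-- A continuous velocity field with values in `[lo, up]`, where `lo > 0`. -/
structure IsSpeed (lo up : ℝ) (a : ℝ → ℝ) : Prop where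
  pos : 0 < lo
  continuous : Continuous a
  lower : ∀ x, lo ≤ a x
  upper : ∀ x, a x ≤ up

/-- The signed time needed to travel from `0` to `x` with speed `a`. -/
noncomputable def travelTime (a : ℝ → ℝ) (x : ℝ) : ℝ := ∫ y in (0 : ℝ)..x, (a y)⁻¹

/-- The position reached from `0` in time `t` with speed `a`. -/
noncomputable def position (a : ℝ → ℝ) : ℝ → ℝ := Function.invFun (travelTime a)

/-- The foot at time `0` of the characteristic through `(t, x)`. -/
noncomputable def charFoot (a : ℝ → ℝ) (t x : ℝ) : ℝ := position a (travelTime a x - t)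

/-! ### Travel time and characteristics -/

namespace IsSpeed

variable {lo up : ℝ} {a : ℝ → ℝ}

theorem apply_pos (h : IsSpeed lo up a) (x : ℝ) : 0 < a x := h.pos.trans_le (h.lower x)

theorem up_pos (h : IsSpeed lo up a) : 0 < up := (h.apply_pos 0).trans_le (h.upper 0)

theorem continuous_inv (h : IsSpeed lo up a) : Continuous fun x => (a x)⁻¹ :=
  h.continuous.inv₀ fun x => (h.apply_pos x).ne'

theorem intervalIntegrable_inv (h : IsSpeed lo up a) (x y : ℝ) :
    IntervalIntegrable (fun z => (a z)⁻¹) volume x y :=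
  h.continuous_inv.intervalIntegrable x y

theorem travelTime_sub (h : IsSpeed lo up a) (x y : ℝ) :
    travelTime a y - travelTime a x = ∫ z in x..y, (a z)⁻¹ :=
  intervalIntegral.integral_interval_sub_left (h.intervalIntegrable_inv _ _)
    (h.intervalIntegrable_inv _ _)

theorem hasDerivAt_travelTime (h : IsSpeed lo up a) (x : ℝ) :
    HasDerivAt (travelTime a) (a x)⁻¹ x :=
  intervalIntegral.integral_hasDerivAt_right (h.intervalIntegrable_inv _ _)
    (h.continuous_inv.stronglyMeasurableAtFilter _ _) h.continuous_inv.continuousAt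

theorem le_travelTime_sub (h : IsSpeed lo up a) {x y : ℝ} (hxy : x ≤ y) :
    (y - x) / up ≤ travelTime a y - travelTime a x := by
  rw [h.travelTime_sub]
  calc (y - x) / up = ∫ _z in x..y, up⁻¹ := by simp [div_eq_mul_inv]
    _ ≤ _ := intervalIntegral.integral_mono_on hxy (by simp) (h.intervalIntegrable_inv _ _)
      fun z _ => inv_anti₀ (h.apply_pos z) (h.upper z)

theorem travelTime_sub_le (h : IsSpeed lo up a) {x y : ℝ} (hxy : x ≤ y) :
    travelTime a y - travelTime a x ≤ (y - x) / lo := by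
  rw [h.travelTime_sub]
  calc _ ≤ ∫ _z in x..y, lo⁻¹ :=
      intervalIntegral.integral_mono_on hxy (h.intervalIntegrable_inv _ _) (by simp)
        fun z _ => inv_anti₀ h.pos (h.lower z)
    _ = (y - x) / lo := by simp [div_eq_mul_inv]

theorem abs_sub_le (h : IsSpeed lo up a) (x y : ℝ) :
    |x - y| ≤ up * |travelTime a x - travelTime a y| := by
  wlog hxy : y ≤ x generalizing x y
  · rw [abs_sub_comm, abs_sub_comm (travelTime a x)]
    exact this y x (le_of_not_ge hxy)
  rw [abs_of_nonneg (sub_nonneg.2 hxy), mul_comm, ← div_le_iff₀ h.up_pos]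
  exact (h.le_travelTime_sub hxy).trans (le_abs_self _)

theorem abs_travelTime_sub_le (h : IsSpeed lo up a) (x y : ℝ) :
    |travelTime a x - travelTime a y| ≤ |x - y| / lo := by
  wlog hxy : y ≤ x generalizing x y
  · rw [abs_sub_comm, abs_sub_comm x]
    exact this y x (le_of_not_ge hxy)
  have h1 := h.le_travelTime_sub hxy
  have h2 : 0 ≤ (x - y) / up := div_nonneg (sub_nonneg.2 hxy) h.up_pos.le
  rw [abs_of_nonneg (sub_nonneg.2 hxy), abs_of_nonneg (h2.trans h1)]
  exact h.travelTime_sub_le hxy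

theorem injective_travelTime (h : IsSpeed lo up a) : Function.Injective (travelTime a) := by
  intro x y hxy
  have := h.abs_sub_le x y
  rw [hxy, sub_self, abs_zero, mul_zero] at this
  exact sub_eq_zero.1 (abs_nonpos_iff.1 this)

theorem continuous_travelTime (h : IsSpeed lo up a) : Continuous (travelTime a) :=
  continuous_iff_continuousAt.2 fun x => (h.hasDerivAt_travelTime x).continuousAt

theorem surjective_travelTime (h : IsSpeed lo up a) : Function.Surjective (travelTime a) := by
  have h0 : travelTime a 0 = 0 := by simp [travelTime]
  apply h.continuous_travelTime.surjective
  · apply tendsto_atTop_mono' _ _ (tendsto_id.atTop_div_const h.up_pos)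
    filter_upwards [eventually_ge_atTop 0] with x hx
    simpa [h0] using h.le_travelTime_sub hx
  · apply tendsto_atBot_mono' _ _ (tendsto_id.atBot_div_const h.up_pos)
    filter_upwards [eventually_le_atBot 0] with x hx
    have := h.le_travelTime_sub hx
    rw [h0, zero_sub, zero_sub, neg_div] at this
    exact neg_le_neg_iff.1 this

theorem travelTime_position (h : IsSpeed lo up a) (s : ℝ) :
    travelTime a (position a s) = s :=
  Function.invFun_eq (h.surjective_travelTime s)

theorem position_travelTime (h : IsSpeed lo up a) (x : ℝ) :
    position a (travelTime a x) = x :=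
  Function.leftInverse_invFun h.injective_travelTime x

theorem abs_position_sub_le (h : IsSpeed lo up a) (s t : ℝ) :
    |position a s - position a t| ≤ up * |s - t| := by
  simpa only [h.travelTime_position] using h.abs_sub_le (position a s) (position a t)

theorem continuous_position (h : IsSpeed lo up a) : Continuous (position a) :=
  LipschitzWith.continuous (K := up.toNNReal) <| LipschitzWith.of_dist_le_mul fun s t => by
    simpa [Real.dist_eq, h.up_pos.le] using h.abs_position_sub_le s t

theorem hasDerivAt_position (h : IsSpeed lo up a) (s : ℝ) :
    HasDerivAt (position a) (a (position a s)) s := by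
  simpa using (h.hasDerivAt_travelTime (position a s)).of_local_left_inverse
    h.continuous_position.continuousAt (inv_ne_zero (h.apply_pos _).ne')
    (Eventually.of_forall h.travelTime_position)

theorem contDiff_travelTime (h : IsSpeed lo up a) : ContDiff ℝ 1 (travelTime a) := by
  rw [contDiff_one_iff_deriv]
  refine ⟨fun x => (h.hasDerivAt_travelTime x).differentiableAt, ?_⟩
  rw [funext fun x => (h.hasDerivAt_travelTime x).deriv]
  exact h.continuous_inv

theorem contDiff_position (h : IsSpeed lo up a) : ContDiff ℝ 1 (position a) := by
  rw [contDiff_one_iff_deriv]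
  refine ⟨fun x => (h.hasDerivAt_position x).differentiableAt, ?_⟩
  rw [funext fun x => (h.hasDerivAt_position x).deriv]
  exact h.continuous.comp h.continuous_position

theorem charFoot_zero (h : IsSpeed lo up a) (x : ℝ) : charFoot a 0 x = x := by
  simp [charFoot, h.position_travelTime]

theorem travelTime_charFoot (h : IsSpeed lo up a) (t x : ℝ) :
    travelTime a (charFoot a t x) = travelTime a x - t := h.travelTime_position _

theorem charFoot_position (h : IsSpeed lo up a) (t s : ℝ) :
    charFoot a t (position a (s + t)) = position a s := by
  simp [charFoot, h.travelTime_position]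

theorem abs_charFoot_sub_self_le (h : IsSpeed lo up a) (t x : ℝ) :
    |charFoot a t x - x| ≤ up * |t| := by
  simpa [h.travelTime_charFoot] using h.abs_sub_le (charFoot a t x) x

theorem lipschitzWith_charFoot (h : IsSpeed lo up a) :
    LipschitzWith (up * (1 / lo + 1)).toNNReal fun p : ℝ × ℝ => charFoot a p.1 p.2 := by
  have hlo := h.pos
  have hup := h.up_pos
  refine LipschitzWith.of_dist_le_mul fun p q => ?_
  rw [Real.coe_toNNReal _ (by positivity), Real.dist_eq, mul_assoc]
  refine (h.abs_position_sub_le _ _).trans (mul_le_mul_of_nonneg_left ?_ hup.le)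
  have h1 : |p.2 - q.2| ≤ dist p q := by
    rw [← Real.dist_eq, Prod.dist_eq]; exact le_max_right _ _
  have h2 : |p.1 - q.1| ≤ dist p q := by
    rw [← Real.dist_eq, Prod.dist_eq]; exact le_max_left _ _
  have h3 := (h.abs_travelTime_sub_le p.2 q.2).trans (div_le_div_of_nonneg_right h1 hlo.le)
  calc |travelTime a p.2 - p.1 - (travelTime a q.2 - q.1)|
      = |(travelTime a p.2 - travelTime a q.2) - (p.1 - q.1)| := by ring_nf
    _ ≤ |travelTime a p.2 - travelTime a q.2| + |p.1 - q.1| := abs_sub _ _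
    _ ≤ dist p q / lo + dist p q := add_le_add h3 h2
    _ = (1 / lo + 1) * dist p q := by ring

/-- Feet of characteristics depend continuously on the speed in the uniform norm. -/
theorem abs_charFoot_sub_le {b : ℝ → ℝ} (ha : IsSpeed lo up a) (hb : IsSpeed lo up b) {η : ℝ}
    (hη : ∀ x, |b x - a x| ≤ η) (t x : ℝ) :
    |charFoot b t x - charFoot a t x| ≤ up * (η / lo ^ 2 * |x - charFoot a t x|) := by
  have hlo := ha.pos
  refine (hb.abs_sub_le _ _).trans (mul_le_mul_of_nonneg_left ?_ ha.up_pos.le)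
  set y := charFoot a t x with hy
  -- Both feet lie at travel time `t` from `x`, each for its own speed, so the discrepancy is the
  -- integral of the difference of slownesses between `y` and `x`.
  have e : travelTime b (charFoot b t x) - travelTime b y
      = ∫ z in y..x, ((b z)⁻¹ - (a z)⁻¹) := by
    rw [intervalIntegral.integral_sub (hb.intervalIntegrable_inv _ _)
      (ha.intervalIntegrable_inv _ _), ← hb.travelTime_sub, ← ha.travelTime_sub,
      hb.travelTime_charFoot, hy, ha.travelTime_charFoot]
    ring
  rw [e]
  refine intervalIntegral.norm_integral_le_of_norm_le_const (f := fun z => (b z)⁻¹ - (a z)⁻¹)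
    fun z _ => ?_
  have h1 := ha.apply_pos z
  have h2 := hb.apply_pos z
  rw [inv_sub_inv h2.ne' h1.ne', Real.norm_eq_abs, abs_div, abs_of_pos (mul_pos h2 h1),
    abs_sub_comm]
  have h3 : lo ^ 2 ≤ b z * a z := by
    rw [sq]; exact mul_le_mul (hb.lower z) (ha.lower z) hlo.le h2.le
  exact div_le_div₀ ((abs_nonneg _).trans (hη z)) (hη z) (by positivity) h3

end IsSpeed

/-! ### Mollification -/

namespace IsMollifier

variable {ρ f : ℝ → ℝ} {δ : ℝ}

theorem scaledKernel_eq_zero (h : IsMollifier ρ) (hδ : 0 < δ) {x : ℝ} (hx : δ ≤ |x|) :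
    scaledKernel ρ δ x = 0 := by
  rw [scaledKernel, h.eq_zero _ (by rwa [abs_div, abs_of_pos hδ, one_le_div hδ]), mul_zero]

theorem scaledKernel_nonneg (h : IsMollifier ρ) (hδ : 0 < δ) (x : ℝ) : 0 ≤ scaledKernel ρ δ x :=
  mul_nonneg (by positivity) (h.nonneg _)

theorem integral_scaledKernel (h : IsMollifier ρ) (hδ : 0 < δ) :
    ∫ x, scaledKernel ρ δ x = 1 := by
  simp only [scaledKernel]
  rw [integral_const_mul, Measure.integral_comp_div, h.integral_eq_one, abs_of_pos hδ, smul_eq_mul]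
  field_simp

theorem contDiff_scaledKernel (h : IsMollifier ρ) : ContDiff ℝ ∞ (scaledKernel ρ δ) :=
  contDiff_const.mul (h.smooth.comp (contDiff_id.div_const δ))

theorem hasCompactSupport_scaledKernel (h : IsMollifier ρ) (hδ : 0 < δ) :
    HasCompactSupport (scaledKernel ρ δ) :=
  HasCompactSupport.intro (isCompact_Icc (a := -δ) (b := δ)) fun x hx => by
    refine h.scaledKernel_eq_zero hδ (le_of_not_gt fun hlt => hx ?_)
    exact ⟨(abs_lt.1 hlt).1.le, (abs_lt.1 hlt).2.le⟩

theorem contDiff_mollify (h : IsMollifier ρ) (hδ : 0 < δ) (hf : Continuous f) :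
    ContDiff ℝ ∞ (mollify ρ δ f) :=
  (h.hasCompactSupport_scaledKernel hδ).contDiff_convolution_right
    (ContinuousLinearMap.mul ℝ ℝ) hf.locallyIntegrable h.contDiff_scaledKernel

/-- The kernel is a probability density supported within distance `δ`. The reference value `c` is
left free: the midpoint of the range gives preservation of bounds, and `f x` gives the Hölder error.
-/
theorem abs_mollify_sub_le (h : IsMollifier ρ) (hδ : 0 < δ) (hf : Continuous f) {x c B : ℝ}
    (hB : ∀ y, |y - x| ≤ δ → |f y - c| ≤ B) : |mollify ρ δ f x - c| ≤ B := by
  have h0 : 0 ≤ B := (abs_nonneg _).trans (hB x (by simpa using hδ.le))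
  have hsupp : Function.support (scaledKernel ρ δ) ⊆ Metric.ball (0 : ℝ) δ := fun y hy => by
    rw [mem_ball_zero_iff, Real.norm_eq_abs]
    exact lt_of_not_ge fun hle => hy (h.scaledKernel_eq_zero hδ hle)
  have key := dist_convolution_le (μ := volume) (x₀ := x) (z₀ := c) h0 hsupp
    (h.scaledKernel_nonneg hδ) (h.integral_scaledKernel hδ) hf.aestronglyMeasurable
    (fun y hy => by
      rw [Real.dist_eq]
      exact hB y (by rw [← Real.dist_eq]; exact (Metric.mem_ball.1 hy).le))
  have e : mollify ρ δ f x
      = (scaledKernel ρ δ ⋆[ContinuousLinearMap.lsmul ℝ ℝ, volume] f : ℝ → ℝ) x := by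
    rw [mollify, convolution_eq_swap, convolution_def]
    simp [mul_comm]
  rwa [e, ← Real.dist_eq]

theorem isSpeed_mollify (h : IsMollifier ρ) (hδ : 0 < δ) {lo up : ℝ} (hf : IsSpeed lo up f) :
    IsSpeed lo up (mollify ρ δ f) := by
  have key : ∀ x, |mollify ρ δ f x - (lo + up) / 2| ≤ (up - lo) / 2 := fun x =>
    h.abs_mollify_sub_le hδ hf.continuous fun y _ => by
      rw [abs_le]
      constructor <;> linarith [hf.lower y, hf.upper y]
  exact ⟨hf.pos, (h.contDiff_mollify hδ hf.continuous).continuous,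
    fun x => by linarith [(abs_le.1 (key x)).1], fun x => by linarith [(abs_le.1 (key x)).2]⟩

end IsMollifier

theorem HolderWith.abs_sub_le {f : ℝ → ℝ} {C r : ℝ≥0} (hf : HolderWith C r f) (x y : ℝ) :
    |f x - f y| ≤ C * |x - y| ^ (r : ℝ) := by
  simpa [Real.dist_eq] using hf.dist_le x y

theorem HolderWith.abs_mollify_sub_self_le {ρ f : ℝ → ℝ} {δ : ℝ} {C r : ℝ≥0}
    (hf : HolderWith C r f) (hr : 0 < r) (h : IsMollifier ρ) (hδ : 0 < δ) (x : ℝ) :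
    |mollify ρ δ f x - f x| ≤ C * δ ^ (r : ℝ) :=
  h.abs_mollify_sub_le hδ (hf.continuous hr) fun y hy => (hf.abs_sub_le y x).trans <| by gcongr

/-! ### The regularized problem and its limit -/

theorem IsSpeed.hasDerivAt_charFoot_left {lo up : ℝ} {a : ℝ → ℝ} (h : IsSpeed lo up a)
    (t x : ℝ) : HasDerivAt (fun s => charFoot a s x) (-a (charFoot a t x)) t := by
  simpa [charFoot, Function.comp_def] using (h.hasDerivAt_position (travelTime a x - t)).comp t
    ((hasDerivAt_id t).const_sub (travelTime a x))

theorem IsSpeed.hasDerivAt_charFoot_right {lo up : ℝ} {a : ℝ → ℝ} (h : IsSpeed lo up a)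
    (t x : ℝ) : HasDerivAt (fun y => charFoot a t y) (a (charFoot a t x) * (a x)⁻¹) x := by
  simpa [charFoot, Function.comp_def] using (h.hasDerivAt_position (travelTime a x - t)).comp x
    ((h.hasDerivAt_travelTime x).sub_const t)

theorem IsSpeed.contDiff_charFoot {lo up : ℝ} {a : ℝ → ℝ} (h : IsSpeed lo up a) :
    ContDiff ℝ 1 (fun p : ℝ × ℝ => charFoot a p.1 p.2) :=
  h.contDiff_position.comp ((h.contDiff_travelTime.comp contDiff_snd).sub contDiff_fst)

section

variable {ρ a w₀ : ℝ → ℝ} {lo up δ T : ℝ}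

/-- The classical solution of the regularized problem, by the method of characteristics. -/
theorem isRegularizedSolution_charFoot (hρ : IsMollifier ρ) (ha : IsSpeed lo up a)
    (hw₀ : Continuous w₀) (hδ : 0 < δ) :
    IsRegularizedSolution ρ δ a w₀ T
      (fun t x => mollify ρ δ w₀ (charFoot (mollify ρ δ a) t x)) := by
  have hb := hρ.isSpeed_mollify hδ ha
  have hm := hρ.contDiff_mollify hδ hw₀
  have hc : ContDiff ℝ 1 (fun p : ℝ × ℝ =>
      mollify ρ δ w₀ (charFoot (mollify ρ δ a) p.1 p.2)) :=
    (hm.of_le (mod_cast le_top)).comp hb.contDiff_charFoot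
  refine ⟨hc.continuous.continuousOn, hc.contDiffOn, fun t _ x => ?_, fun x => ?_⟩
  · have hd := (hm.differentiable (by simp)
      (charFoot (mollify ρ δ a) t x)).hasDerivAt
    have h1 := (hd.comp t (hb.hasDerivAt_charFoot_left t x)).div_const (mollify ρ δ a x)
    have h2 := hd.comp x (hb.hasDerivAt_charFoot_right t x)
    simp only [Function.comp_def] at h1 h2
    rw [h1.deriv, h2.deriv]
    ring
  · simp [hb.charFoot_zero]

/-- Classical solutions are constant along characteristics. -/
theorem IsRegularizedSolution.eq_charFoot {v : ℝ → ℝ → ℝ} (hρ : IsMollifier ρ)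
    (ha : IsSpeed lo up a) (hδ : 0 < δ) (hv : IsRegularizedSolution ρ δ a w₀ T v) {t : ℝ}
    (ht : t ∈ Icc 0 T) (x : ℝ) :
    v t x = mollify ρ δ w₀ (charFoot (mollify ρ δ a) t x) := by
  have hb := hρ.isSpeed_mollify hδ ha
  set b := mollify ρ δ a with hbdef
  -- The forward characteristic from the foot at time `0` to `x` at time `t`.
  set X : ℝ → ℝ := fun s => position b (travelTime b (charFoot b t x) + s) with hX
  have hXd : ∀ s, HasDerivAt X (b (X s)) s := fun s => by
    simpa [Function.comp_def] using
      (hb.hasDerivAt_position (travelTime b (charFoot b t x) + s)).comp s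
        ((hasDerivAt_id s).const_add (travelTime b (charFoot b t x)))
  have hXc : Continuous X := continuous_iff_continuousAt.2 fun s => (hXd s).continuousAt
  have hX0 : X 0 = charFoot b t x := by simp [hX, hb.position_travelTime]
  have hXt : X t = x := by simp [hX, hb.travelTime_charFoot, hb.position_travelTime]
  rcases ht.1.eq_or_lt with h0 | h0
  · rw [← h0, hv.initial, hb.charFoot_zero]
  have hcont : ContinuousOn (fun s => v s (X s)) (Icc 0 t) :=
    hv.continuousOn.comp (f := fun s => (s, X s)) (by fun_prop)
      fun s hs => ⟨⟨hs.1, hs.2.trans ht.2⟩, mem_univ _⟩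
  have hder : ∀ s ∈ Ioo 0 t, HasDerivAt (fun s => v s (X s)) 0 s := fun s hs => by
    have hs' : s ∈ Ioo 0 T := ⟨hs.1, hs.2.trans_le ht.2⟩
    have hopen : IsOpen (Ioo 0 T ×ˢ (univ : Set ℝ)) := isOpen_Ioo.prod isOpen_univ
    have hd : HasFDerivAt (fun p : ℝ × ℝ => v p.1 p.2)
        (fderiv ℝ (fun p : ℝ × ℝ => v p.1 p.2) (s, X s)) (s, X s) :=
      ((hv.contDiffOn.differentiableOn (by simp)).differentiableAt
        (hopen.mem_nhds ⟨hs', mem_univ _⟩)).hasFDerivAt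
    set F := fderiv ℝ (fun p : ℝ × ℝ => v p.1 p.2) (s, X s)
    have h1 : HasDerivAt (fun r => v r (X s)) (F (1, 0)) s :=
      HasFDerivAt.comp_hasDerivAt (f := fun r => (r, X s)) s hd
        ((hasDerivAt_id s).prodMk (hasDerivAt_const s (X s)))
    have h2 : HasDerivAt (fun y => v s y) (F (0, 1)) (X s) :=
      HasFDerivAt.comp_hasDerivAt (f := fun y => (s, y)) (X s) hd
        ((hasDerivAt_const (X s) s).prodMk (hasDerivAt_id (X s)))
    have h3 : HasDerivAt (fun r => v r (X r)) (F (1, b (X s))) s :=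
      HasFDerivAt.comp_hasDerivAt (f := fun r => (r, X r)) s hd
        ((hasDerivAt_id s).prodMk (hXd s))
    have heq := hv.equation s hs' (X s)
    rw [← hbdef, (h1.div_const _).deriv, h2.deriv] at heq
    have e : F (1, b (X s)) = F (1, 0) + b (X s) * F (0, 1) := by
      have : ((1 : ℝ), b (X s)) = (1, 0) + b (X s) • ((0 : ℝ), (1 : ℝ)) := by simp
      rw [this, map_add, map_smul, smul_eq_mul]
    have e2 : F (1, b (X s)) = 0 := by
      rw [e]
      have hne := (hb.apply_pos (X s)).ne'
      field_simp at heq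
      linarith
    rwa [e2] at h3
  -- The equation is available only at interior times; the mean value theorem needs just continuity
  -- at the endpoints.
  obtain ⟨c, -, hc⟩ := exists_hasDerivAt_eq_slope (fun s => v s (X s)) (fun _ => 0) h0 hcont hder
  rw [eq_comm, div_eq_zero_iff, or_iff_left (by linarith), sub_eq_zero] at hc
  rw [hXt, hX0, hv.initial] at hc
  exact hc

/-- Mollifying the speed moves the foot by `O(δ ^ α)`, mollifying the datum changes its values
uniformly by `O(δ ^ γ)`, and the datum is continuous. -/
theorem tendsto_mollify_charFoot {A α H γ : ℝ≥0} (hρ : IsMollifier ρ) (ha : IsSpeed lo up a)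
    (haH : HolderWith A α a) (hα : 0 < α) (hwH : HolderWith H γ w₀) (hγ : 0 < γ) (t x : ℝ) :
    Tendsto (fun δ => mollify ρ δ w₀ (charFoot (mollify ρ δ a) t x)) (𝓝[>] 0)
      (𝓝 (w₀ (charFoot a t x))) := by
  have hpow : ∀ r : ℝ≥0, 0 < r → ∀ K : ℝ,
      Tendsto (fun δ : ℝ => K * δ ^ (r : ℝ)) (𝓝[>] 0) (𝓝 0) := fun r hr K => by
    have : ContinuousAt (fun δ : ℝ => K * δ ^ (r : ℝ)) 0 :=
      continuousAt_const.mul (Real.continuousAt_rpow_const _ _ (Or.inr hr.le))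
    have h := this.tendsto.mono_left (nhdsWithin_le_nhds (s := Ioi 0))
    rwa [Real.zero_rpow (by exact_mod_cast hr.ne'), mul_zero] at h
  have hfoot : Tendsto (fun δ => charFoot (mollify ρ δ a) t x) (𝓝[>] 0) (𝓝 (charFoot a t x)) := by
    rw [tendsto_iff_dist_tendsto_zero]
    refine squeeze_zero' (Eventually.of_forall fun _ => dist_nonneg) ?_
      (hpow α hα (up * (A / lo ^ 2 * |x - charFoot a t x|)))
    filter_upwards [self_mem_nhdsWithin] with δ hδ
    rw [Real.dist_eq]
    refine (ha.abs_charFoot_sub_le (hρ.isSpeed_mollify hδ ha)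
      (haH.abs_mollify_sub_self_le hα hρ hδ) t x).trans_eq ?_
    ring
  have h1 := ((hwH.continuous hγ).tendsto (charFoot a t x)).comp hfoot
  have h2 : Tendsto (fun δ => mollify ρ δ w₀ (charFoot (mollify ρ δ a) t x)
      - w₀ (charFoot (mollify ρ δ a) t x)) (𝓝[>] 0) (𝓝 0) := by
    refine squeeze_zero_norm' ?_ (hpow γ hγ H)
    filter_upwards [self_mem_nhdsWithin] with δ hδ
    exact hwH.abs_mollify_sub_self_le hγ hρ hδ _
  simpa [Function.comp_def] using h2.add h1

theorem isRegularizationLimit_charFoot {A α H γ : ℝ≥0} (hρ : IsMollifier ρ)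
    (ha : IsSpeed lo up a) (haH : HolderWith A α a) (hα : 0 < α) (hwH : HolderWith H γ w₀)
    (hγ : 0 < γ) : IsRegularizationLimit ρ a w₀ T fun t x => w₀ (charFoot a t x) :=
  ⟨fun δ t x => mollify ρ δ w₀ (charFoot (mollify ρ δ a) t x),
    fun _ hδ => isRegularizedSolution_charFoot hρ ha (hwH.continuous hγ) hδ,
    fun t _ x => tendsto_mollify_charFoot hρ ha haH hα hwH hγ t x⟩

/-- Uniqueness of classical solutions makes the limit independent of the chosen family. -/
theorem IsRegularizationLimit.eq_charFoot {A α H γ : ℝ≥0} {w : ℝ → ℝ → ℝ} (hρ : IsMollifier ρ)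
    (ha : IsSpeed lo up a) (haH : HolderWith A α a) (hα : 0 < α) (hwH : HolderWith H γ w₀)
    (hγ : 0 < γ) (hw : IsRegularizationLimit ρ a w₀ T w) {t : ℝ} (ht : t ∈ Icc 0 T) (x : ℝ) :
    w t x = w₀ (charFoot a t x) := by
  obtain ⟨v, hv, hlim⟩ := hw
  refine tendsto_nhds_unique (hlim t ht x)
    ((tendsto_mollify_charFoot hρ ha haH hα hwH hγ t x).congr' ?_)
  filter_upwards [self_mem_nhdsWithin] with δ hδ
  exact ((hv δ hδ).eq_charFoot hρ ha hδ ht x).symm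

end

/-! ### The weak formulation -/

section

variable {a w₀ : ℝ → ℝ} {lo up : ℝ}

/-- Substitution of Lagrangian coordinates at time `t`. -/
theorem IsSpeed.integral_eq_integral_position (h : IsSpeed lo up a) (t : ℝ) (F : ℝ → ℝ) :
    ∫ x, F x = ∫ s, a (position a (s + t)) * F (position a (s + t)) := by
  have himg : (fun s => position a (s + t)) '' univ = univ :=
    image_univ_of_surjective fun x => ⟨travelTime a x - t, by simp [h.position_travelTime]⟩
  have hinj : InjOn (fun s => position a (s + t)) univ := fun x _ y _ hxy => by
    simpa [h.travelTime_position] using congrArg (travelTime a) hxy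
  have hd : ∀ s ∈ (univ : Set ℝ), HasDerivWithinAt (fun s => position a (s + t))
      (a (position a (s + t))) univ s := fun s _ => by
    simpa [Function.comp_def] using ((h.hasDerivAt_position (s + t)).comp s
      ((hasDerivAt_id s).add_const t)).hasDerivWithinAt (s := univ)
  have key := integral_image_eq_integral_abs_deriv_smul MeasurableSet.univ hd hinj F
  rw [himg] at key
  simpa [abs_of_pos (h.apply_pos _)] using key

/-- The passage to Lagrangian coordinates `(t, x) ↦ (t, travelTime a x - t)`. -/
noncomputable def IsSpeed.lagrangian (h : IsSpeed lo up a) : ℝ × ℝ ≃ₜ ℝ × ℝ where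
  toFun p := (p.1, position a (p.2 + p.1))
  invFun p := (p.1, travelTime a p.2 - p.1)
  left_inv p := by simp [h.travelTime_position]
  right_inv p := by simp [h.position_travelTime]
  continuous_toFun := continuous_fst.prodMk
    (h.continuous_position.comp (continuous_snd.add continuous_fst))
  continuous_invFun := continuous_fst.prodMk
    ((h.continuous_travelTime.comp continuous_snd).sub continuous_fst)

theorem IsSpeed.lagrangian_apply (h : IsSpeed lo up a) (s ξ : ℝ) :
    h.lagrangian (s, ξ) = (s, position a (ξ + s)) := rfl

/-- In Lagrangian coordinates the solution does not depend on time, and the Jacobian `a` cancels the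
weight `1 / a`. The space-time integrand becomes the time derivative of the slice integrand, so
Fubini and the fundamental theorem of calculus leave the two end slices. -/
theorem IsSpeed.weak_formulation (h : IsSpeed lo up a) (hw₀ : Continuous w₀) {φ : ℝ × ℝ → ℝ}
    (hφ : ContDiff ℝ ∞ φ) (hφc : HasCompactSupport φ) (t : ℝ) :
    (∫ s in (0 : ℝ)..t, ∫ x, (w₀ (charFoot a s x) / a x * deriv (fun r => φ (r, x)) s
        + w₀ (charFoot a s x) * deriv (fun y => φ (s, y)) x))
      + ∫ x, w₀ x / a x * φ (0, x)
    = ∫ x, w₀ (charFoot a t x) / a x * φ (t, x) := by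
  have hdφ : ∀ p, HasFDerivAt φ (fderiv ℝ φ p) p := fun p =>
    (hφ.differentiable (by simp) p).hasFDerivAt
  have hdt : ∀ s x, deriv (fun r => φ (r, x)) s = fderiv ℝ φ (s, x) (1, 0) := fun s x =>
    (HasFDerivAt.comp_hasDerivAt (f := fun r => (r, x)) s (hdφ (s, x))
      ((hasDerivAt_id s).prodMk (hasDerivAt_const s x))).deriv
  have hdx : ∀ s x, deriv (fun y => φ (s, y)) x = fderiv ℝ φ (s, x) (0, 1) := fun s x =>
    (HasFDerivAt.comp_hasDerivAt (f := fun y => (s, y)) x (hdφ (s, x))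
      ((hasDerivAt_const x s).prodMk (hasDerivAt_id x))).deriv
  have hcd : ∀ v, Continuous fun p => fderiv ℝ φ p v := fun v =>
    (hφ.continuous_fderiv (by simp)).clm_apply continuous_const
  set Q : ℝ × ℝ → ℝ := fun p =>
    fderiv ℝ φ p (1, 0) + a p.2 * fderiv ℝ φ p (0, 1) with hQ
  have hQc : Continuous Q := (hcd _).add ((h.continuous.comp continuous_snd).mul (hcd _))
  have hQs : HasCompactSupport Q :=
    (hφc.fderiv_apply ℝ (1, 0)).add (HasCompactSupport.mul_left (hφc.fderiv_apply ℝ (0, 1)))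
  set R : ℝ × ℝ → ℝ := fun p => w₀ (position a p.2) * Q (h.lagrangian p) with hR
  have hRc : Continuous R := (hw₀.comp (h.continuous_position.comp continuous_snd)).mul
    (hQc.comp h.lagrangian.continuous)
  have hRs : HasCompactSupport R := HasCompactSupport.mul_left (hQs.comp_homeomorph h.lagrangian)
  have hRi : Integrable R (volume.prod volume) := hRc.integrable_of_hasCompactSupport hRs
  have inner : ∀ s, ∫ x, (w₀ (charFoot a s x) / a x * deriv (fun r => φ (r, x)) s
        + w₀ (charFoot a s x) * deriv (fun y => φ (s, y)) x) = ∫ ξ, R (s, ξ) := fun s => by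
    rw [h.integral_eq_integral_position s]
    refine integral_congr_ae (Eventually.of_forall fun ξ => ?_)
    have hne := (h.apply_pos (position a (ξ + s))).ne'
    simp only [hdt, hdx, h.charFoot_position, hR, hQ, h.lagrangian_apply]
    field_simp
  have slice : ∀ s, ∫ x, w₀ (charFoot a s x) / a x * φ (s, x)
      = ∫ ξ, w₀ (position a ξ) * φ (h.lagrangian (s, ξ)) := fun s => by
    rw [h.integral_eq_integral_position s]
    refine integral_congr_ae (Eventually.of_forall fun ξ => ?_)
    have hne := (h.apply_pos (position a (ξ + s))).ne'
    simp only [h.charFoot_position, h.lagrangian_apply]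
    field_simp
  have hslice_int : ∀ s, Integrable fun ξ => w₀ (position a ξ) * φ (h.lagrangian (s, ξ)) :=
    fun s => by
      refine Continuous.integrable_of_hasCompactSupport
        ((hw₀.comp h.continuous_position).mul (hφ.continuous.comp
          (h.lagrangian.continuous.comp (by fun_prop)))) (HasCompactSupport.mul_left ?_)
      -- A time slice is a closed isometric copy of the line, so compact support passes to it.
      exact (hφc.comp_homeomorph h.lagrangian).comp_isClosedEmbedding
        (Isometry.of_dist_eq fun x y => by simp [Prod.dist_eq]).isClosedEmbedding
  have hder : ∀ s ξ, HasDerivAt (fun r => w₀ (position a ξ) * φ (h.lagrangian (r, ξ)))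
      (R (s, ξ)) s := fun s ξ => by
    have hp : HasDerivAt (fun r => h.lagrangian (r, ξ)) ((1 : ℝ), a (position a (ξ + s))) s := by
      have := (h.hasDerivAt_position (ξ + s)).comp s ((hasDerivAt_id s).const_add ξ)
      rw [mul_one] at this
      exact (hasDerivAt_id s).prodMk this
    have := (HasFDerivAt.comp_hasDerivAt (f := fun r => h.lagrangian (r, ξ)) s (hdφ _) hp).const_mul
      (w₀ (position a ξ))
    have e : ((1 : ℝ), a (position a (ξ + s)))
        = (1, 0) + a (position a (ξ + s)) • ((0 : ℝ), (1 : ℝ)) := by simp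
    rw [e, map_add, map_smul, smul_eq_mul] at this
    exact this
  have ftc : ∀ ξ, ∫ s in (0 : ℝ)..t, R (s, ξ)
      = w₀ (position a ξ) * φ (h.lagrangian (t, ξ))
        - w₀ (position a ξ) * φ (h.lagrangian (0, ξ)) := fun ξ =>
    intervalIntegral.integral_eq_sub_of_hasDerivAt (fun s _ => hder s ξ)
      ((hRc.comp (by fun_prop : Continuous fun s : ℝ => (s, ξ))).intervalIntegrable _ _)
  have swap := intervalIntegral_integral_swap (a := 0) (b := t) (μ := volume)
    (f := fun s ξ => R (s, ξ)) (by
      have := hRi.restrict (s := uIoc 0 t ×ˢ univ)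
      rwa [← Measure.prod_restrict, Measure.restrict_univ] at this)
  have zero : ∫ x, w₀ x / a x * φ (0, x)
      = ∫ ξ, w₀ (position a ξ) * φ (h.lagrangian (0, ξ)) := by
    rw [← slice]
    simp only [h.charFoot_zero]
  simp only [inner]
  rw [swap, slice, zero]
  simp only [ftc]
  rw [integral_sub (hslice_int t) (hslice_int 0), sub_add_cancel]

theorem IsSpeed.isWeakSolution {H γ : ℝ≥0} {T : ℝ} {w : ℝ → ℝ → ℝ} (h : IsSpeed lo up a)
    (hwH : HolderWith H γ w₀) (hγ : 0 < γ)
    (hw : ∀ t ∈ Icc 0 T, ∀ x, w t x = w₀ (charFoot a t x)) : IsWeakSolution a w₀ T w := by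
  refine ⟨⟨γ * 1, H * (up * (1 / lo + 1)).toNNReal ^ (γ : ℝ), by simpa using hγ, fun p hp q hq => ?_⟩, fun φ hφ hφc t ht => ?_⟩
  · beta_reduce
    rw [hw p.1 hp.1, hw q.1 hq.1]
    exact (hwH.comp h.lipschitzWith_charFoot.holderWith) p q
  · rw [← (funext fun x => by rw [hw t (Ioc_subset_Icc_self ht)] :
      (fun x => w₀ (charFoot a t x) / a x * φ (t, x)) = fun x => w t x / a x * φ (t, x)),
      ← h.weak_formulation (hwH.continuous hγ) hφ hφc t]
    congr 1
    refine intervalIntegral.integral_congr fun s hs => ?_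
    rw [uIcc_of_le ht.1.le] at hs
    simp only [hw s ⟨hs.1, hs.2.trans ht.2⟩]

end

/-! ### Sequences with prescribed increments and cell averages -/

/-- Partial sums in both directions from `g 0 = 0`. This supplies the discrete travel time. -/
theorem exists_backward_difference_eq (c : ℤ → ℝ) : ∃ g : ℤ → ℝ, ∀ j, g j - g (j - 1) = c j := by
  refine ⟨fun j => match j with
    | Int.ofNat n => ∑ i ∈ Finset.range n, c (i + 1)
    | Int.negSucc n => -∑ i ∈ Finset.range (n + 1), c (-i), fun j => ?_⟩
  obtain ⟨n, rfl | rfl⟩ := j.eq_nat_or_neg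
  · rcases n with _ | n
    · change (∑ i ∈ Finset.range 0, c (i + 1)) - (-∑ i ∈ Finset.range (0 + 1), c (-i)) = _
      simp
    · have e : ((n + 1 : ℕ) : ℤ) - 1 = Int.ofNat n := by simp
      rw [e]
      change (∑ i ∈ Finset.range (n + 1), c (i + 1)) - ∑ i ∈ Finset.range n, c (i + 1) = _
      rw [Finset.sum_range_succ]
      simp
  · rcases n with _ | n
    · change (∑ i ∈ Finset.range 0, c (i + 1)) - (-∑ i ∈ Finset.range (0 + 1), c (-i)) = _
      simp
    · have e : -((n + 1 : ℕ) : ℤ) - 1 = Int.negSucc (n + 1) := by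
        rw [Int.negSucc_eq]; push_cast; ring
      have e' : -((n + 1 : ℕ) : ℤ) = Int.negSucc n := by rw [Int.negSucc_eq]; push_cast; ring
      rw [e, e']
      change (-∑ i ∈ Finset.range (n + 1), c (-i)) - (-∑ i ∈ Finset.range (n + 1 + 1), c (-i)) = _
      rw [Finset.sum_range_succ _ (n + 1), ← e']
      ring

theorem mul_sub_le_of_le_backward_difference {f : ℤ → ℝ} {η : ℝ}
    (hf : ∀ j, η ≤ f j - f (j - 1)) {i j : ℤ} (hij : j ≤ i) :
    η * (i - j : ℝ) ≤ f i - f j := by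
  induction i, hij using Int.leInduction with
  | base => simp
  | succ k _ ih =>
    have := hf (k + 1)
    rw [add_sub_cancel_right] at this
    push_cast
    linarith

theorem mul_abs_sub_le_of_le_backward_difference {f : ℤ → ℝ} {η : ℝ}
    (hf : ∀ j, η ≤ f j - f (j - 1)) (i j : ℤ) : η * |(i - j : ℝ)| ≤ |f i - f j| := by
  wlog hij : j ≤ i generalizing i j
  · rw [abs_sub_comm, abs_sub_comm (f i)]
    exact this j i (le_of_not_ge hij)
  rw [abs_of_nonneg (sub_nonneg.2 (by exact_mod_cast hij) : (0 : ℝ) ≤ i - j)]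
  exact (mul_sub_le_of_le_backward_difference hf hij).trans (le_abs_self _)

theorem abs_sub_le_of_abs_backward_difference_le {f : ℤ → ℝ} {η : ℝ}
    (hf : ∀ j, |f j - f (j - 1)| ≤ η) (i j : ℤ) : |f i - f j| ≤ η * |(i - j : ℝ)| := by
  wlog hij : j ≤ i generalizing i j
  · rw [abs_sub_comm, abs_sub_comm (i : ℝ)]
    exact this j i (le_of_not_ge hij)
  rw [abs_of_nonneg (sub_nonneg.2 (by exact_mod_cast hij) : (0 : ℝ) ≤ i - j), abs_le]
  have h1 := mul_sub_le_of_le_backward_difference (f := f) (η := -η)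
    (fun j => (abs_le.1 (hf j)).1) hij
  have h2 := mul_sub_le_of_le_backward_difference (f := fun j => -f j) (η := -η)
    (fun j => by linarith [(abs_le.1 (hf j)).2]) hij
  constructor <;> linarith

theorem cell_length {h : ℝ} (j : ℤ) : (j : ℝ) * h - ((j : ℝ) - 1) * h = h := by ring

theorem abs_cellAverage_sub_le {f : ℝ → ℝ} {h k B : ℝ} (hf : Continuous f) (hh : 0 < h) (j : ℤ)
    (hB : ∀ y ∈ Icc (((j : ℝ) - 1) * h) (j * h), |f y - k| ≤ B) :
    |cellAverage f h j - k| ≤ B := by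
  have e : cellAverage f h j - k = 1 / h * ∫ x in (((j : ℝ) - 1) * h)..((j : ℝ) * h), (f x - k) := by
    rw [intervalIntegral.integral_sub (hf.intervalIntegrable _ _) (by simp), cellAverage,
      intervalIntegral.integral_const, cell_length, smul_eq_mul]
    field_simp
  have hle : ((j : ℝ) - 1) * h ≤ j * h := by linarith [cell_length (h := h) j]
  have key := intervalIntegral.norm_integral_le_of_norm_le_const (f := fun x => f x - k)
    (a := ((j : ℝ) - 1) * h) (b := j * h) (C := B) fun y hy => by
      rw [uIoc_of_le hle] at hy
      exact hB y (Ioc_subset_Icc_self hy)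
  rw [cell_length, abs_of_pos hh, Real.norm_eq_abs] at key
  rw [e, abs_mul, abs_of_pos (by positivity), one_div, inv_mul_le_iff₀ hh, mul_comm h]
  exact key

theorem IsSpeed.cellAverage_mem {lo up h : ℝ} {a : ℝ → ℝ} (ha : IsSpeed lo up a) (hh : 0 < h)
    (j : ℤ) : lo ≤ cellAverage a h j ∧ cellAverage a h j ≤ up := by
  have := abs_cellAverage_sub_le (k := (lo + up) / 2) (B := (up - lo) / 2) ha.continuous hh j
    fun y _ => by rw [abs_le]; constructor <;> linarith [ha.lower y, ha.upper y]
  rw [abs_le] at this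
  constructor <;> linarith

/-! ### The upwind scheme as a random walk -/

section

variable {lo up θ h : ℝ} {a w₀ : ℝ → ℝ} {g : ℤ → ℝ}

theorem upwind_succ (hh : 0 < h) (n : ℕ) (j : ℤ) :
    upwind a w₀ (θ * h) h (n + 1) j
      = (1 - θ * cellAverage a h j) * upwind a w₀ (θ * h) h n j
        + θ * cellAverage a h j * upwind a w₀ (θ * h) h n (j - 1) := by
  rw [upwind, backwardDiff]
  field_simp
  ring

/-- A quadratic bound in the discrete travel time `g` on the initial data propagates: along the
scheme `g` behaves like a martingale with drift. -/
theorem abs_upwind_sub_le_quadratic (ha : IsSpeed lo up a) (hh : 0 < h) (hθ : 0 < θ)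
    (hcfl : θ * up ≤ 1) (hg : ∀ j, g j - g (j - 1) = h / cellAverage a h j) {k B E m : ℝ}
    (hE : 0 ≤ E) (h0 : ∀ i, |cellAverage w₀ h i - k| ≤ B + E * (g i - m) ^ 2) (n : ℕ) :
    ∀ j, |upwind a w₀ (θ * h) h n j - k|
      ≤ B + E * ((g j - n * (θ * h) - m) ^ 2 + n * (θ * h) * (h / lo)) := by
  induction n with
  | zero => intro j; simpa [upwind] using h0 j
  | succ n ih =>
    intro j
    obtain ⟨hc0, hc1⟩ := ha.cellAverage_mem hh j
    have hlo := ha.pos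
    set c := cellAverage a h j with hc
    have hcpos : 0 < c := hlo.trans_le hc0
    set s := θ * c with hs
    have hs0 : 0 ≤ s := by positivity
    have hs1 : s ≤ 1 := (mul_le_mul_of_nonneg_left hc1 hθ.le).trans hcfl
    have e : upwind a w₀ (θ * h) h (n + 1) j - k
        = (1 - s) * (upwind a w₀ (θ * h) h n j - k)
          + s * (upwind a w₀ (θ * h) h n (j - 1) - k) := by
      rw [upwind_succ hh, ← hc, ← hs]; ring
    have hgj : g (j - 1) = g j - h / c := by linarith [hg j]
    have i1 := mul_le_mul_of_nonneg_left (ih j) (sub_nonneg.2 hs1)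
    have i2 := mul_le_mul_of_nonneg_left (ih (j - 1)) hs0
    rw [hgj] at i2
    rw [e]
    refine (abs_add_le _ _).trans ?_
    rw [abs_mul, abs_mul, abs_of_nonneg (sub_nonneg.2 hs1), abs_of_nonneg hs0]
    refine (add_le_add i1 i2).trans ?_
    -- The mean displacement in `g` is the same in every cell: the jump probability is proportional
    -- to `c`, the jump length to `1 / c`.
    have hsc : s * (h / c) = θ * h := by rw [hs]; field_simp
    have hvar : h / c ≤ h / lo := div_le_div_of_nonneg_left hh.le hlo hc0
    push_cast
    set y := g j - n * (θ * h) - m with hy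
    have e1 : g j - h / c - n * (θ * h) - m = y - h / c := by rw [hy]; ring
    have e2 : g j - (n + 1) * (θ * h) - m = y - θ * h := by rw [hy]; ring
    rw [e1, e2]
    have e3 : (1 - s) * (B + E * (y ^ 2 + n * (θ * h) * (h / lo)))
        + s * (B + E * ((y - h / c) ^ 2 + n * (θ * h) * (h / lo)))
        = B + E * (y ^ 2 - 2 * y * (s * (h / c)) + s * (h / c) * (h / c)
          + n * (θ * h) * (h / lo)) := by ring
    rw [e3, hsc]
    refine add_le_add_right (mul_le_mul_of_nonneg_left ?_ hE) _
    -- The second moment of one step. Recentring at the mean would subtract `(θ * h) ^ 2`, which is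
    -- discarded.
    have : θ * h * (h / c) ≤ θ * h * (h / lo) := mul_le_mul_of_nonneg_left hvar (by positivity)
    nlinarith [sq_nonneg (θ * h)]

/-- The maximum principle, as the case of vanishing quadratic coefficient. -/
theorem abs_upwind_sub_le (ha : IsSpeed lo up a) (hh : 0 < h) (hθ : 0 < θ)
    (hcfl : θ * up ≤ 1) {k B : ℝ} (h0 : ∀ i, |cellAverage w₀ h i - k| ≤ B) (n : ℕ) (j : ℤ) :
    |upwind a w₀ (θ * h) h n j - k| ≤ B := by
  obtain ⟨g, hg⟩ := exists_backward_difference_eq fun j => h / cellAverage a h j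
  simpa using abs_upwind_sub_le_quadratic ha hh hθ hcfl hg (m := 0) le_rfl (by simpa using h0) n j

theorem mul_abs_sub_le_discrete_travelTime (ha : IsSpeed lo up a) (hh : 0 < h)
    (hg : ∀ j, g j - g (j - 1) = h / cellAverage a h j) (i j : ℤ) :
    |(i * h - j * h : ℝ)| ≤ up * |g i - g j| := by
  have := mul_abs_sub_le_of_le_backward_difference (f := g) (η := h / up) (fun j => by
    obtain ⟨h1, h2⟩ := ha.cellAverage_mem hh j
    rw [hg]
    exact div_le_div_of_nonneg_left hh.le (ha.pos.trans_le h1) h2) i j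
  rw [← sub_mul, abs_mul, abs_of_pos hh, ← div_le_iff₀' ha.up_pos]
  exact (by ring : |(i - j : ℝ)| * h / up = h / up * |(i - j : ℝ)|).trans_le this

/-- Consistency of the discrete travel time. -/
theorem abs_discrete_travelTime_sub_le {A α : ℝ≥0} (ha : IsSpeed lo up a)
    (haH : HolderWith A α a) (hh : 0 < h)
    (hg : ∀ j, g j - g (j - 1) = h / cellAverage a h j) (i j : ℤ) :
    |(travelTime a (i * h) - travelTime a (j * h)) - (g i - g j)|
      ≤ A * h ^ (α : ℝ) / lo ^ 2 * |(i * h - j * h : ℝ)| := by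
  have hlo := ha.pos
  -- The error is summed cell by cell: in each cell the slowness differs from the inverse cell
  -- average by at most `A h ^ α / lo ^ 2`.
  have key := abs_sub_le_of_abs_backward_difference_le
    (f := fun j : ℤ => travelTime a (j * h) - g j) (η := A * h ^ (α : ℝ) / lo ^ 2 * h)
    (fun j => by
      obtain ⟨hc0, _⟩ := ha.cellAverage_mem hh j
      set c := cellAverage a h j with hc
      have hcpos : 0 < c := hlo.trans_le hc0
      have e : travelTime a (j * h) - g j - (travelTime a ((j - 1 : ℤ) * h) - g (j - 1))
          = ∫ y in (((j : ℝ) - 1) * h)..(j * h), ((a y)⁻¹ - c⁻¹) := by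
        rw [intervalIntegral.integral_sub (ha.intervalIntegrable_inv _ _) (by simp),
          ← ha.travelTime_sub, intervalIntegral.integral_const, cell_length, smul_eq_mul,
          ← div_eq_mul_inv, hc, ← hg]
        push_cast
        ring
      have hle : ((j : ℝ) - 1) * h ≤ j * h := by linarith [cell_length (h := h) j]
      have bound := intervalIntegral.norm_integral_le_of_norm_le_const
        (f := fun y => (a y)⁻¹ - c⁻¹) (a := ((j : ℝ) - 1) * h) (b := j * h)
        (C := A * h ^ (α : ℝ) / lo ^ 2) fun y hy => by
          rw [uIoc_of_le hle] at hy
          have hay := ha.apply_pos y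
          have h1 : |c - a y| ≤ A * h ^ (α : ℝ) :=
            abs_cellAverage_sub_le ha.continuous hh j fun z hz =>
              (haH.abs_sub_le z y).trans <| by
                have : |z - y| ≤ h := by
                  rw [abs_le]
                  constructor <;> linarith [hz.1, hz.2, hy.1, hy.2, cell_length (h := h) j]
                gcongr
          rw [inv_sub_inv hay.ne' hcpos.ne', Real.norm_eq_abs, abs_div,
            abs_of_pos (mul_pos hay hcpos)]
          have h3 : lo ^ 2 ≤ a y * c := by
            rw [sq]; exact mul_le_mul (ha.lower y) hc0 hlo.le hay.le
          exact div_le_div₀ (by positivity) h1 (by positivity) h3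
      rw [cell_length, abs_of_pos hh] at bound
      rw [e]
      exact bound) i j
  calc _ = |travelTime a (i * h) - g i - (travelTime a (j * h) - g j)| := by congr 1; ring
    _ ≤ _ := key
    _ = _ := by rw [← sub_mul, abs_mul, abs_of_pos hh]; ring

end

/-- Trades a Hölder modulus for quadratic growth, which the scheme propagates. -/
theorem rpow_le_one_add_sq {s r : ℝ} (hs : 0 ≤ s) (hr0 : 0 ≤ r) (hr2 : r ≤ 2) :
    s ^ r ≤ 1 + s ^ 2 := by
  rcases le_total s 1 with h | h
  · linarith [Real.rpow_le_one hs h hr0, sq_nonneg s]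
  · have := Real.rpow_le_rpow_of_exponent_le h hr2
    rw [Real.rpow_two] at this
    linarith

/-! ### Error estimates on fine meshes and decay far away -/

section

variable {lo up θ h τ T L M : ℝ} {a w₀ : ℝ → ℝ} {g : ℤ → ℝ} {A α H γ : ℝ≥0}

/-- The constant relating the distance to the foot of the characteristic with the discrete travel
time. -/
noncomputable def footConst (lo up A T : ℝ) : ℝ :=
  up * (up * A / lo ^ 2 + 1 + up * T * A / lo ^ 2 + 2 / lo) + 1

/-- In travel time, the distance to the foot splits into the consistency error of `g`, the deviation
from the drifted centre `g j - s`, and the rounding of `x` and `τ` to the grid. The scale `ε`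
dominates all but the deviation. The extra `h` on the left covers every point of cell `i`. -/
theorem abs_sub_charFoot_le (ha : IsSpeed lo up a) (haH : HolderWith A α a) (hh : 0 < h)
    (hg : ∀ j, g j - g (j - 1) = h / cellAverage a h j) {ε s x : ℝ} (hε1 : ε ≤ 1)
    (hαε : h ^ (α : ℝ) ≤ ε) (hhε : h ≤ ε) (hs0 : 0 ≤ s) (hsT : s ≤ T) (hsτ : |τ - s| ≤ h / lo)
    {j : ℤ} (hx : |(j : ℝ) * h - x| ≤ h) (i : ℤ) :
    |(i : ℝ) * h - charFoot a τ x| + h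
      ≤ footConst lo up A T * (|g i - (g j - s)| + ε) := by
  have hlo := ha.pos
  have hup := ha.up_pos
  have hA : (0 : ℝ) ≤ A := A.2
  set d := |g i - (g j - s)| with hd
  have hd0 : 0 ≤ d := abs_nonneg _
  have hε0 : 0 ≤ ε := hh.le.trans hhε
  have hgij : |g i - g j| ≤ d + T := by
    have e : g i - g j = (g i - (g j - s)) - s := by ring
    rw [e]
    refine (abs_sub _ _).trans ?_
    rw [abs_of_nonneg hs0]
    linarith
  have h1 : |(travelTime a (i * h) - travelTime a (j * h)) - (g i - g j)|
      ≤ A * ε / lo ^ 2 * (up * (d + T)) := by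
    refine (abs_discrete_travelTime_sub_le ha haH hh hg i j).trans ?_
    have := (mul_abs_sub_le_discrete_travelTime ha hh hg i j).trans
      (mul_le_mul_of_nonneg_left hgij hup.le)
    gcongr
  have h2 : |travelTime a (j * h) - travelTime a x| ≤ ε / lo :=
    (ha.abs_travelTime_sub_le _ _).trans
      (div_le_div_of_nonneg_right (hx.trans hhε) hlo.le)
  have h3 : |τ - s| ≤ ε / lo := hsτ.trans (div_le_div_of_nonneg_right hhε hlo.le)
  have h4 : |travelTime a (i * h) - travelTime a (charFoot a τ x)|
      ≤ A * ε / lo ^ 2 * (up * (d + T)) + d + ε / lo + ε / lo := by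
    rw [ha.travelTime_charFoot]
    have e : travelTime a (i * h) - (travelTime a x - τ)
        = ((travelTime a (i * h) - travelTime a (j * h)) - (g i - g j)) + (g i - (g j - s))
          + (travelTime a (j * h) - travelTime a x) + (τ - s) := by ring
    rw [e]
    refine (abs_add_le _ _).trans (add_le_add ((abs_add_le _ _).trans (add_le_add
      ((abs_add_le _ _).trans (add_le_add h1 le_rfl)) h2)) h3)
  have h5 := (ha.abs_sub_le (i * h) (charFoot a τ x)).trans (mul_le_mul_of_nonneg_left h4 hup.le)
  have hT : 0 ≤ T := hs0.trans hsT
  have h6 : A * ε / lo ^ 2 * (up * (d + T)) + d + ε / lo + ε / lo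
      ≤ (up * A / lo ^ 2 + 1 + up * T * A / lo ^ 2 + 2 / lo) * (d + ε) := by
    -- The consistency error grows with `d`; `ε ≤ 1` absorbs the product into a multiple of `d`.
    have p1 : ε * (up * A / lo ^ 2 * d) ≤ 1 * (up * A / lo ^ 2 * d) :=
      mul_le_mul_of_nonneg_right hε1 (by positivity)
    have p2 : 0 ≤ up * A / lo ^ 2 * ε + ε + up * T * A / lo ^ 2 * d + 2 / lo * d := by positivity
    have e1 : A * ε / lo ^ 2 * (up * (d + T)) + d + ε / lo + ε / lo
        = ε * (up * A / lo ^ 2 * d) + up * T * A / lo ^ 2 * ε + d + 2 / lo * ε := by ring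
    have e2 : (up * A / lo ^ 2 + 1 + up * T * A / lo ^ 2 + 2 / lo) * (d + ε)
        = 1 * (up * A / lo ^ 2 * d) + up * T * A / lo ^ 2 * ε + d + 2 / lo * ε
          + (up * A / lo ^ 2 * ε + ε + up * T * A / lo ^ 2 * d + 2 / lo * d) := by ring
    linarith
  have h7 := mul_le_mul_of_nonneg_left h6 hup.le
  rw [footConst]
  nlinarith

/-- The error constant on bounded sets. -/
noncomputable def localErrorConst (lo up A H T : ℝ) : ℝ :=
  H * (1 + 2 * footConst lo up A T ^ 2 * (1 + T / lo))

/-- At scale `ε` the Hölder bound is dominated by `ε ^ γ` plus a quadratic term with coefficient of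
order `ε ^ (γ - 2)`. The accumulated variance is at most `T ε ^ 2 / lo`, so both contributions have
order `ε ^ γ`. -/
theorem abs_upwind_sub_charFoot_le (ha : IsSpeed lo up a) (haH : HolderWith A α a)
    (hwH : HolderWith H γ w₀) (hγ0 : 0 < γ) (hγ1 : γ ≤ 1) (hh : 0 < h) (hθ : 0 < θ)
    (hcfl : θ * up ≤ 1) {ε x : ℝ} (hε0 : 0 < ε) (hε1 : ε ≤ 1) (hαε : h ^ (α : ℝ) ≤ ε)
    (hhε : h ≤ ε ^ 2) {n : ℕ} (hnT : n * (θ * h) ≤ T) (hnτ : |τ - n * (θ * h)| ≤ h / lo)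
    {j : ℤ} (hx : |(j : ℝ) * h - x| ≤ h) :
    |upwind a w₀ (θ * h) h n j - w₀ (charFoot a τ x)|
      ≤ localErrorConst lo up A H T * ε ^ (γ : ℝ) := by
  obtain ⟨g, hg⟩ := exists_backward_difference_eq fun j => h / cellAverage a h j
  have hlo := ha.pos
  have hH : (0 : ℝ) ≤ H := H.2
  have hγ1' : (γ : ℝ) ≤ 1 := by exact_mod_cast hγ1
  set c := footConst lo up A T with hc
  -- The centre is the mean position of the walk run back from `j`, so only the variance survives at
  -- step `n`.
  set m := g j - n * (θ * h) with hm
  have h0 : ∀ i, |cellAverage w₀ h i - w₀ (charFoot a τ x)|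
      ≤ H * ε ^ (γ : ℝ) * (1 + 2 * c ^ 2)
        + H * ε ^ (γ : ℝ) * (2 * c ^ 2 / ε ^ 2) * (g i - m) ^ 2 := fun i => by
    refine abs_cellAverage_sub_le (hwH.continuous hγ0) hh i fun y hy => ?_
    refine (hwH.abs_sub_le _ _).trans ?_
    have hd := abs_sub_charFoot_le (τ := τ) ha haH hh hg hε1 hαε (by nlinarith)
      (by positivity : 0 ≤ n * (θ * h)) hnT hnτ hx i
    rw [← hc, ← hm] at hd
    set r := |(i : ℝ) * h - charFoot a τ x| + h with hr
    have hr0 : 0 ≤ r := by positivity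
    have hyr : |y - charFoot a τ x| ≤ r := by
      have e : y - charFoot a τ x = (i * h - charFoot a τ x) + (y - i * h) := by ring
      rw [e]
      refine (abs_add_le _ _).trans (add_le_add le_rfl ?_)
      rw [abs_le]
      constructor <;> linarith [hy.1, hy.2, cell_length (h := h) i]
    have h1 : r ^ (γ : ℝ) ≤ ε ^ (γ : ℝ) * (1 + (r / ε) ^ 2) := by
      have e : r ^ (γ : ℝ) = ε ^ (γ : ℝ) * (r / ε) ^ (γ : ℝ) := by
        rw [← Real.mul_rpow hε0.le (by positivity)]
        congr 1
        field_simp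
      rw [e]
      exact mul_le_mul_of_nonneg_left (rpow_le_one_add_sq (by positivity) γ.2 (by linarith))
        (by positivity)
    have h2 : r ^ 2 ≤ c ^ 2 * (2 * ((g i - m) ^ 2 + ε ^ 2)) := by
      refine (pow_le_pow_left₀ hr0 hd 2).trans ?_
      rw [mul_pow]
      refine mul_le_mul_of_nonneg_left ?_ (sq_nonneg c)
      rw [← sq_abs (g i - m)]
      nlinarith [sq_nonneg (|g i - m| - ε)]
    have h3 : (r / ε) ^ 2 ≤ 2 * c ^ 2 + 2 * c ^ 2 / ε ^ 2 * (g i - m) ^ 2 := by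
      rw [div_pow, div_le_iff₀ (by positivity)]
      refine h2.trans_eq ?_
      field_simp
      ring
    calc (H : ℝ) * |y - charFoot a τ x| ^ (γ : ℝ) ≤ H * r ^ (γ : ℝ) := by gcongr
      _ ≤ H * (ε ^ (γ : ℝ) * (1 + (2 * c ^ 2 + 2 * c ^ 2 / ε ^ 2 * (g i - m) ^ 2))) := by
        refine mul_le_mul_of_nonneg_left (h1.trans ?_) hH
        gcongr
      _ = _ := by ring
  refine (abs_upwind_sub_le_quadratic ha hh hθ hcfl hg (by positivity) h0 n j).trans ?_
  have e0 : g j - n * (θ * h) - m = 0 := by rw [hm]; ring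
  rw [e0]
  have hT0 : 0 ≤ T := le_trans (by positivity) hnT
  have h4 : n * (θ * h) * (h / lo) ≤ T * (ε ^ 2 / lo) := by gcongr
  calc H * ε ^ (γ : ℝ) * (1 + 2 * c ^ 2)
        + H * ε ^ (γ : ℝ) * (2 * c ^ 2 / ε ^ 2) * (0 ^ 2 + n * (θ * h) * (h / lo))
      ≤ H * ε ^ (γ : ℝ) * (1 + 2 * c ^ 2)
        + H * ε ^ (γ : ℝ) * (2 * c ^ 2 / ε ^ 2) * (0 ^ 2 + T * (ε ^ 2 / lo)) := by gcongr
    _ = localErrorConst lo up A H T * ε ^ (γ : ℝ) := by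
      rw [localErrorConst, ← hc]
      field_simp
      ring

/-- The CFL condition bounds the time step by `h / lo`, which keeps `θ` out of the constants. -/
theorem floor_time_bounds (ha : IsSpeed lo up a) (hh : 0 < h) (hθ : 0 < θ) (hcfl : θ * up ≤ 1)
    (hτ : 0 ≤ τ) : ⌊τ / (θ * h)⌋₊ * (θ * h) ≤ τ ∧ |τ - ⌊τ / (θ * h)⌋₊ * (θ * h)| ≤ h / lo := by
  have hθh : 0 < θ * h := mul_pos hθ hh
  have h1 := Nat.floor_le (div_nonneg hτ hθh.le)
  have h2 := Nat.lt_floor_add_one (τ / (θ * h))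
  rw [le_div_iff₀ hθh] at h1
  rw [div_lt_iff₀ hθh] at h2
  refine ⟨h1, ?_⟩
  rw [abs_of_nonneg (by linarith), le_div_iff₀ ha.pos]
  have h3 : θ * lo ≤ 1 :=
    (mul_le_mul_of_nonneg_left ((ha.lower 0).trans (ha.upper 0)) hθ.le).trans hcfl
  nlinarith [ha.pos]

theorem floor_space_bounds (hh : 0 < h) (x : ℝ) : |((⌊x / h⌋ + 1 : ℤ) : ℝ) * h - x| ≤ h := by
  have h1 := Int.floor_le (x / h)
  have h2 := Int.lt_floor_add_one (x / h)
  rw [le_div_iff₀ hh] at h1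
  rw [div_lt_iff₀ hh] at h2
  push_cast
  rw [abs_le]
  constructor <;> linarith

/-- The convergence rate. -/
noncomputable def upwindRate (α γ : ℝ) : ℝ := γ * α / (γ * α + 2 - γ)

theorem upwindRate_pos (hα0 : 0 < α) (hγ0 : 0 < γ) (hγ1 : γ ≤ 1) : 0 < upwindRate α γ := by
  have h1 : (0 : ℝ) < α := hα0
  have h2 : (0 : ℝ) < γ := hγ0
  have h3 : (γ : ℝ) ≤ 1 := by exact_mod_cast hγ1
  have : (0 : ℝ) < γ * α := by positivity
  exact div_pos this (by linarith)

theorem upwindRate_le_one (hα0 : 0 < α) (hγ0 : 0 < γ) (hγ1 : γ ≤ 1) : upwindRate α γ ≤ 1 := by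
  have h1 : (0 : ℝ) < α := hα0
  have h2 : (0 : ℝ) < γ := hγ0
  have h3 : (γ : ℝ) ≤ 1 := by exact_mod_cast hγ1
  have : (0 : ℝ) < γ * α := by positivity
  rw [upwindRate, div_le_one (by linarith)]
  linarith

/-- Uniform error estimate on fine meshes. -/
theorem abs_sub_upwindApprox_le (ha : IsSpeed lo up a) (haH : HolderWith A α a)
    (hwH : HolderWith H γ w₀) (hα0 : 0 < α) (hα1 : α ≤ 1) (hγ0 : 0 < γ) (hγ1 : γ ≤ 1)
    (hh : 0 < h) (hh1 : h ≤ 1) (hθ : 0 < θ) (hcfl : θ * up ≤ 1) (hτ : 0 ≤ τ) (hτT : τ ≤ T)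
    (x : ℝ) :
    |w₀ (charFoot a τ x) - upwindApprox a w₀ (θ * h) h τ x|
      ≤ localErrorConst lo up A H T * h ^ upwindRate α γ := by
  have h1 : (0 : ℝ) < α := hα0
  have h2 : (0 : ℝ) < γ := hγ0
  have h3 : (γ : ℝ) ≤ 1 := by exact_mod_cast hγ1
  have h4 : (α : ℝ) ≤ 1 := by exact_mod_cast hα1
  have hpos : (0 : ℝ) < γ * α := by positivity
  -- The target rate divided by `γ`. The scale `h ^ q` is admissible because `q ≤ α` and `q ≤ 1 /
  -- 2`.
  set q : ℝ := α / (γ * α + 2 - γ) with hq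
  have hden : (0 : ℝ) < γ * α + 2 - γ := by linarith
  have hq0 : 0 < q := div_pos h1 hden
  have hqα : q ≤ α := by
    rw [hq, div_le_iff₀ hden]
    nlinarith
  have hq2 : q * 2 ≤ 1 := by
    rw [hq, div_mul_eq_mul_div, div_le_iff₀ hden]
    nlinarith
  have hrate : h ^ upwindRate α γ = (h ^ q) ^ (γ : ℝ) := by
    rw [← Real.rpow_mul hh.le, upwindRate, hq]
    congr 1
    ring
  obtain ⟨t1, t2⟩ := floor_time_bounds ha hh hθ hcfl hτ
  rw [hrate, abs_sub_comm]
  refine abs_upwind_sub_charFoot_le ha haH hwH hγ0 hγ1 hh hθ hcfl (Real.rpow_pos_of_pos hh q)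
    (Real.rpow_le_one hh.le hh1 hq0.le) (Real.rpow_le_rpow_of_exponent_ge hh hh1 hqα) ?_
    (t1.trans hτT) t2 (floor_space_bounds hh x)
  rw [← Real.rpow_natCast, ← Real.rpow_mul hh.le]
  calc h = h ^ (1 : ℝ) := (Real.rpow_one h).symm
    _ ≤ h ^ (q * (2 : ℕ)) := Real.rpow_le_rpow_of_exponent_ge hh hh1 (by exact_mod_cast hq2)

/-- Decay of the numerical solution away from the support of the data. -/
theorem abs_upwind_le_of_far (ha : IsSpeed lo up a) (hh : 0 < h) (hθ : 0 < θ)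
    (hcfl : θ * up ≤ 1) {μ x : ℝ} (hμ : 0 ≤ μ) (h0 : ∀ i, |cellAverage w₀ h i| ≤ μ)
    (hsupp : ∀ i : ℤ, L + h < |i * h| → cellAverage w₀ h i = 0) {n : ℕ}
    (hnT : n * (θ * h) ≤ T) {j : ℤ} (hx : |(j : ℝ) * h - x| ≤ h)
    (hfar : 2 * L + 4 * h + 2 * up * T + 1 ≤ |x|) :
    |upwind a w₀ (θ * h) h n j| ≤ 4 * up ^ 2 * T / lo * (μ * h) / (1 + |x|) ^ 2 := by
  obtain ⟨g, hg⟩ := exists_backward_difference_eq fun j => h / cellAverage a h j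
  have hlo := ha.pos
  have hup := ha.up_pos
  set m := g j - n * (θ * h) with hm
  -- A lower bound for the discrete travel time between the support and the mean position `m`. As
  -- the data vanish closer than `d`, a pure quadratic with coefficient `μ / d ^ 2` dominates them,
  -- as in Chebyshev's inequality.
  set d := (1 + |x|) / (2 * up) with hd
  have hd0 : 0 < d := by positivity
  have hn0 : 0 ≤ n * (θ * h) := by positivity
  have key : ∀ i, |cellAverage w₀ h i - 0| ≤ 0 + μ / d ^ 2 * (g i - m) ^ 2 := fun i => by
    rw [sub_zero, zero_add]
    by_cases hi : L + h < |i * h|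
    · rw [hsupp i hi, abs_zero]; positivity
    · push Not at hi
      have h1 := mul_abs_sub_le_discrete_travelTime ha hh hg i j
      have h2 : |x| - L - 2 * h ≤ |(i * h - j * h : ℝ)| := by
        have e : x = -(i * h - j * h) - (j * h - x) + i * h := by ring
        have : |x| ≤ |(i * h - j * h : ℝ)| + |j * h - x| + |i * h| := by
          nth_rewrite 1 [e]
          refine (abs_add_le _ _).trans (add_le_add ((abs_sub _ _).trans ?_) le_rfl)
          rw [abs_neg]
        linarith
      have h3 : |g i - g j| ≤ |g i - m| + n * (θ * h) := by
        have e : g i - g j = (g i - m) - n * (θ * h) := by rw [hm]; ring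
        rw [e]
        refine (abs_sub _ _).trans ?_
        rw [abs_of_nonneg hn0]
      have h4 : d ≤ |g i - m| := by
        rw [hd, div_le_iff₀ (by positivity)]
        have h5 := mul_le_mul_of_nonneg_left (h3.trans (add_le_add le_rfl hnT)) hup.le
        linarith
      have h5 : d ^ 2 ≤ (g i - m) ^ 2 := by
        rw [← sq_abs (g i - m)]; exact pow_le_pow_left₀ hd0.le h4 2
      refine (h0 i).trans ?_
      rw [div_mul_eq_mul_div, le_div_iff₀ (by positivity)]
      exact mul_le_mul_of_nonneg_left h5 hμ
  have := abs_upwind_sub_le_quadratic ha hh hθ hcfl hg (by positivity) key n j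
  have e0 : g j - n * (θ * h) - m = 0 := by rw [hm]; ring
  rw [e0, sub_zero] at this
  refine this.trans ?_
  calc 0 + μ / d ^ 2 * (0 ^ 2 + n * (θ * h) * (h / lo))
      ≤ 0 + μ / d ^ 2 * (0 ^ 2 + T * (h / lo)) := by gcongr
    _ = _ := by rw [hd]; field_simp; ring

/-- For coarse meshes: the mass of the data is spread over a cell of length `h`, so `h` times the
average stays bounded. -/
theorem abs_cellAverage_le_of_support (hh : 0 < h) (hL : 0 ≤ L)
    (hM : ∀ x, |w₀ x| ≤ M) (hsupp : ∀ x, L < |x| → w₀ x = 0) (i : ℤ) :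
    |cellAverage w₀ h i| ≤ 2 * L * M / h := by
  have hle : ((i : ℝ) - 1) * h ≤ i * h := by linarith [cell_length (h := h) i]
  have h1 : ∫ x in (((i : ℝ) - 1) * h)..(i * h), w₀ x
      = ∫ x in Ioc (((i : ℝ) - 1) * h) (i * h) ∩ Icc (-L) L, w₀ x := by
    rw [intervalIntegral.integral_of_le hle]
    refine setIntegral_eq_of_subset_of_forall_sdiff_eq_zero measurableSet_Ioc
      inter_subset_left fun x hx => hsupp x ?_
    refine lt_of_not_ge fun hlt => hx.2 ⟨hx.1, abs_le.1 hlt⟩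
  have hM0 : 0 ≤ M := (abs_nonneg _).trans (hM 0)
  have hvol : volume (Ioc (((i : ℝ) - 1) * h) (i * h) ∩ Icc (-L) L) ≤ ENNReal.ofReal (2 * L) := by
    refine (measure_mono inter_subset_right).trans_eq ?_
    rw [Real.volume_Icc]
    congr 1
    ring
  have h2 := norm_setIntegral_le_of_norm_le_const (f := w₀)
    (hvol.trans_lt ENNReal.ofReal_lt_top) fun x _ => hM x
  have h3 : volume.real (Ioc (((i : ℝ) - 1) * h) (i * h) ∩ Icc (-L) L) ≤ 2 * L :=
    ENNReal.toReal_le_of_le_ofReal (by positivity) hvol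
  rw [cellAverage, h1, abs_mul, abs_of_pos (by positivity), one_div, ← div_eq_inv_mul]
  refine div_le_div_of_nonneg_right (h2.trans ?_) hh.le
  nlinarith

theorem cellAverage_eq_zero_of_support (hw₀ : Continuous w₀) (hh : 0 < h)
    (hsupp : ∀ x, L < |x| → w₀ x = 0) (i : ℤ) (hi : L + h < |i * h|) :
    cellAverage w₀ h i = 0 := by
  have := abs_cellAverage_sub_le (k := 0) (B := 0) hw₀ hh i fun y hy => by
    rw [hsupp y, sub_zero, abs_zero]
    have : |(i : ℝ) * h| ≤ |y| + |i * h - y| := by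
      have e : (i : ℝ) * h = y + (i * h - y) := by ring
      nth_rewrite 1 [e]
      exact abs_add_le _ _
    have h2 : |i * h - y| ≤ h := by
      rw [abs_le]
      constructor <;> linarith [hy.1, hy.2, cell_length (h := h) i]
    linarith
  simpa using this

end

/-! ### Weighted pointwise error on all meshes -/

section

variable {lo up θ h τ T L : ℝ} {a w₀ : ℝ → ℝ} {A α H γ : ℝ≥0}

theorem HolderWith.abs_le_of_support (hwH : HolderWith H γ w₀) (hL : 0 < L)
    (hsupp : ∀ x, L < |x| → w₀ x = 0) (x : ℝ) : |w₀ x| ≤ H * (3 * L) ^ (γ : ℝ) := by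
  by_cases hx : L < |x|
  · rw [hsupp x hx, abs_zero]; positivity
  · push Not at hx
    have h1 := hwH.abs_sub_le x (2 * L)
    rw [hsupp (2 * L) (by rw [abs_of_pos (by positivity)]; linarith), sub_zero] at h1
    have h2 : |x - 2 * L| ≤ 3 * L := by
      rw [abs_le] at hx ⊢
      constructor <;> linarith
    exact h1.trans (by gcongr)

theorem HolderWith.abs_sub_le_of_periodic (hwH : HolderWith H γ w₀) (hL : 0 < L)
    (hper : Function.Periodic w₀ L) (x : ℝ) : |w₀ x - w₀ 0| ≤ H * L ^ (γ : ℝ) := by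
  obtain ⟨y, hy, hxy⟩ := hper.exists_mem_Ico₀ hL x
  rw [hxy]
  refine (hwH.abs_sub_le y 0).trans ?_
  have : |y - 0| ≤ L := by rw [sub_zero, abs_of_nonneg hy.1]; exact hy.2.le
  gcongr

/-- The error constant in the periodic setting. -/
noncomputable def periodicErrorConst (lo up A H γ T L : ℝ) : ℝ :=
  (1 + L) * (localErrorConst lo up A H T + 2 * (H * L ^ γ))

theorem abs_error_le_of_periodic (ha : IsSpeed lo up a) (haH : HolderWith A α a)
    (hwH : HolderWith H γ w₀) (hα0 : 0 < α) (hα1 : α ≤ 1) (hγ0 : 0 < γ) (hγ1 : γ ≤ 1)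
    (hL : 0 < L) (hper : Function.Periodic w₀ L) (hh : 0 < h) (hθ : 0 < θ) (hcfl : θ * up ≤ 1)
    (hτ : 0 ≤ τ) (hτT : τ ≤ T) {x : ℝ} (hx : x ∈ Ico 0 L) :
    |w₀ (charFoot a τ x) - upwindApprox a w₀ (θ * h) h τ x|
      ≤ periodicErrorConst lo up A H γ T L * h ^ upwindRate α γ / (1 + |x|) := by
  have hlo := ha.pos
  have hup := ha.up_pos
  have hT : 0 ≤ T := hτ.trans hτT
  have hK : 0 ≤ localErrorConst lo up A H T := by rw [localErrorConst]; positivity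
  have hM : (0 : ℝ) ≤ H * L ^ (γ : ℝ) := by positivity
  have key : |w₀ (charFoot a τ x) - upwindApprox a w₀ (θ * h) h τ x|
      ≤ (localErrorConst lo up A H T + 2 * (H * L ^ (γ : ℝ))) * h ^ upwindRate α γ := by
    rcases le_total h 1 with h1 | h1
    · refine (abs_sub_upwindApprox_le ha haH hwH hα0 hα1 hγ0 hγ1 hh h1 hθ hcfl hτ hτT x).trans ?_
      exact mul_le_mul_of_nonneg_right (by linarith) (by positivity)
    -- On coarse meshes the factor `h ^ upwindRate α γ` is at least one, so the maximum principle
    -- around `w₀ 0` suffices.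
    · have e1 := hwH.abs_sub_le_of_periodic hL hper
      have e2 : |upwindApprox a w₀ (θ * h) h τ x - w₀ 0| ≤ H * L ^ (γ : ℝ) :=
        abs_upwind_sub_le ha hh hθ hcfl
          (fun i => abs_cellAverage_sub_le (hwH.continuous hγ0) hh i fun y _ => e1 y) _ _
      have e3 := (abs_sub_le (w₀ (charFoot a τ x)) (w₀ 0) (upwindApprox a w₀ (θ * h) h τ x))
      rw [abs_sub_comm (w₀ 0)] at e3
      have e4 : 1 ≤ h ^ upwindRate α γ := Real.one_le_rpow h1 (upwindRate_pos hα0 hγ0 hγ1).le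
      have e5 := e1 (charFoot a τ x)
      nlinarith
  rw [le_div_iff₀ (by positivity), periodicErrorConst, abs_of_nonneg hx.1]
  calc _ ≤ (localErrorConst lo up A H T + 2 * (H * L ^ (γ : ℝ))) * h ^ upwindRate α γ * (1 + L) :=
        mul_le_mul key (by linarith [hx.2]) (by linarith [hx.1]) (by positivity)
    _ = _ := by ring

/-- Beyond this radius the data have no influence up to time `T`. -/
noncomputable def farRadius (up T L : ℝ) : ℝ := 2 * L + 4 + 2 * up * T + 1

/-- The error constant on the whole line. -/
noncomputable def lineErrorConst (lo up A H γ T L : ℝ) : ℝ :=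
  (1 + farRadius up T L) *
      (localErrorConst lo up A H T + H * (3 * L) ^ γ + 2 * L * (H * (3 * L) ^ γ))
    + 4 * up ^ 2 * T / lo * (H * (3 * L) ^ γ + 2 * L * (H * (3 * L) ^ γ))

/-- On fine meshes the uniform estimate covers a fixed ball; outside it the exact solution vanishes
and the scheme decays. On coarse meshes the near zone has size proportional to `h`, compensated by
an amplitude of order `1 / h`. -/
theorem abs_error_le_of_line (ha : IsSpeed lo up a) (haH : HolderWith A α a)
    (hwH : HolderWith H γ w₀) (hα0 : 0 < α) (hα1 : α ≤ 1) (hγ0 : 0 < γ) (hγ1 : γ ≤ 1)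
    (hL : 0 < L) (hsupp : ∀ x, L < |x| → w₀ x = 0) (hh : 0 < h) (hθ : 0 < θ)
    (hcfl : θ * up ≤ 1) (hτ : 0 ≤ τ) (hτT : τ ≤ T) (x : ℝ) :
    |w₀ (charFoot a τ x) - upwindApprox a w₀ (θ * h) h τ x|
      ≤ lineErrorConst lo up A H γ T L * h ^ upwindRate α γ / (1 + |x|) := by
  have hlo := ha.pos
  have hup := ha.up_pos
  have hT : 0 ≤ T := hτ.trans hτT
  have hcont := hwH.continuous hγ0
  set K := localErrorConst lo up A H T with hKdef
  have hK : 0 ≤ K := by rw [hKdef, localErrorConst]; positivity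
  set M : ℝ := H * (3 * L) ^ (γ : ℝ) with hMdef
  have hM : 0 ≤ M := by positivity
  set R := farRadius up T L with hRdef
  have hR : R = 2 * L + 4 + 2 * up * T + 1 := rfl
  set F := 4 * up ^ 2 * T / lo with hFdef
  have hF : 0 ≤ F := by positivity
  have hupT : 0 ≤ up * T := by positivity
  have hR0 : 0 ≤ R := by rw [hR]; linarith
  have hC : lineErrorConst lo up A H γ T L
      = (1 + R) * (K + M + 2 * L * M) + F * (M + 2 * L * M) := rfl
  have hLM : 0 ≤ 2 * L * M := by positivity
  have hx0 := abs_nonneg x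
  obtain ⟨t1, -⟩ := floor_time_bounds ha hh hθ hcfl hτ
  have hM' := hwH.abs_le_of_support hL hsupp
  have hcellM : ∀ i, |cellAverage w₀ h i| ≤ M := fun i => by
    simpa using abs_cellAverage_sub_le (k := 0) hcont hh i fun y _ => by simpa using hM' y
  have hcellLM := abs_cellAverage_le_of_support hh hL.le hM' hsupp
  have hcell0 := cellAverage_eq_zero_of_support hcont hh hsupp
  have hexact : R < |x| → w₀ (charFoot a τ x) = 0 := fun hx => hsupp _ <| by
    have h1 := ha.abs_charFoot_sub_self_le τ x
    rw [abs_of_nonneg hτ] at h1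
    have h2 : |x| ≤ |charFoot a τ x| + |charFoot a τ x - x| := by
      have e : x = charFoot a τ x - (charFoot a τ x - x) := by ring
      nth_rewrite 1 [e]
      exact abs_sub _ _
    have h3 := mul_le_mul_of_nonneg_left hτT hup.le
    linarith
  have hfar : ∀ μ, 0 ≤ μ → (∀ i, |cellAverage w₀ h i| ≤ μ) →
      2 * L + 4 * h + 2 * up * T + 1 ≤ |x| →
      |upwindApprox a w₀ (θ * h) h τ x| * (1 + |x|) ≤ F * (μ * h) := fun μ hμ hμ' hx => by
    have := abs_upwind_le_of_far ha hh hθ hcfl hμ hμ' hcell0 (t1.trans hτT)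
      (floor_space_bounds hh x) hx
    rw [le_div_iff₀ (by positivity)] at this
    refine le_trans ?_ this
    -- One of the two available powers of `1 + |x|` is given up.
    refine mul_le_mul_of_nonneg_left ?_ (abs_nonneg _)
    nlinarith
  rw [le_div_iff₀ (by positivity), hC]
  rcases le_total h 1 with h1 | h1
  · have hp : h ≤ h ^ upwindRate α γ := by
      simpa using Real.rpow_le_rpow_of_exponent_ge hh h1 (upwindRate_le_one hα0 hγ0 hγ1)
    have hp0 : 0 ≤ h ^ upwindRate α γ := hh.le.trans hp
    set P := h ^ upwindRate α γ
    rcases le_or_gt |x| R with hxR | hxR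
    · have := abs_sub_upwindApprox_le ha haH hwH hα0 hα1 hγ0 hγ1 hh h1 hθ hcfl hτ hτT x
      calc _ ≤ K * P * (1 + R) := mul_le_mul this (by linarith) (by linarith) (by positivity)
        _ = ((1 + R) * K) * P := by ring
        _ ≤ _ := mul_le_mul_of_nonneg_right (by
          have q1 : 0 ≤ (1 + R) * (M + 2 * L * M) := by positivity
          have q2 : 0 ≤ F * (M + 2 * L * M) := by positivity
          linarith) hp0
    · rw [hexact hxR, zero_sub, abs_neg]
      refine (hfar M hM hcellM (by linarith)).trans ?_
      calc F * (M * h) ≤ F * (M * P) := by gcongr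
        _ = (F * M) * P := by ring
        _ ≤ _ := mul_le_mul_of_nonneg_right (by
          have q1 : 0 ≤ (1 + R) * (K + M + 2 * L * M) := by positivity
          have q2 : 0 ≤ F * (2 * L * M) := by positivity
          linarith) hp0
  · have hp : 1 ≤ h ^ upwindRate α γ := Real.one_le_rpow h1 (upwindRate_pos hα0 hγ0 hγ1).le
    have hnum : |upwindApprox a w₀ (θ * h) h τ x| * (1 + |x|)
        ≤ (1 + R) * (2 * L * M) + F * (2 * L * M) := by
      have q1 : 0 ≤ (1 + R) * (2 * L * M) := by positivity
      have q2 : 0 ≤ F * (2 * L * M) := by positivity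
      -- For `h ≥ 1` the radius `R * h` exceeds the mesh-dependent threshold of the far-field bound.
      rcases le_or_gt |x| (R * h) with hxR | hxR
      · have : |upwindApprox a w₀ (θ * h) h τ x| ≤ 2 * L * M / h := by
          have := abs_upwind_sub_le (k := 0) (B := 2 * L * M / h) (w₀ := w₀) ha hh hθ hcfl
            (fun i => by simpa using hcellLM i) ⌊τ / (θ * h)⌋₊ (⌊x / h⌋ + 1)
          simpa [upwindApprox] using this
        calc _ ≤ 2 * L * M / h * ((1 + R) * h) :=
              mul_le_mul this (by linarith) (by positivity) (by positivity)
          _ = (1 + R) * (2 * L * M) := by field_simp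
          _ ≤ _ := by linarith
      · refine (hfar (2 * L * M / h) (by positivity) hcellLM ?_).trans ?_
        · rw [hR] at hxR
          nlinarith
        · rw [div_mul_cancel₀ _ hh.ne']
          linarith
    have hex : |w₀ (charFoot a τ x)| * (1 + |x|) ≤ (1 + R) * M := by
      rcases le_or_gt |x| R with hxR | hxR
      · rw [mul_comm (1 + R)]
        exact mul_le_mul (hM' _) (by linarith) (by linarith) hM
      · rw [hexact hxR, abs_zero, zero_mul]; positivity
    have htri := mul_le_mul_of_nonneg_right
      (abs_sub (w₀ (charFoot a τ x)) (upwindApprox a w₀ (θ * h) h τ x))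
      (by linarith : 0 ≤ 1 + |x|)
    have q1 : 0 ≤ (1 + R) * K := by positivity
    have q2 : 0 ≤ F * M := by positivity
    have hCnn : 0 ≤ (1 + R) * (K + M + 2 * L * M) + F * (M + 2 * L * M) := by positivity
    calc _ ≤ (1 + R) * (K + M + 2 * L * M) + F * (M + 2 * L * M) := by linarith
      _ ≤ _ := le_mul_of_one_le_right hCnn hp

end

/-! ### The `L²` estimate and conclusion -/

theorem eLpNorm_inv_one_add_abs_lt_top :
    eLpNorm (fun x : ℝ => (1 + |x|)⁻¹) 2 volume < ⊤ := by
  have hmeas : AEStronglyMeasurable (fun x : ℝ => (1 + |x|)⁻¹) volume :=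
    (by fun_prop : Measurable fun x : ℝ => (1 + |x|)⁻¹).aestronglyMeasurable
  refine ((memLp_two_iff_integrable_sq hmeas).2 ?_).2
  refine integrable_inv_one_add_sq.mono' (hmeas.pow 2) (Eventually.of_forall fun x => ?_)
  rw [Real.norm_eq_abs, abs_of_nonneg (by positivity), inv_pow]
  refine inv_anti₀ (by positivity) ?_
  nlinarith [abs_nonneg x, sq_abs x]

/-- The constant in the pointwise error estimate, for both settings. -/
noncomputable def SpatialDomain.errorConst (D : SpatialDomain) (lo up A H γ T L : ℝ) : ℝ :=
  match D with
  | .periodic => periodicErrorConst lo up A H γ T L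
  | .line => lineErrorConst lo up A H γ T L

theorem SpatialDomain.abs_error_le {lo up θ h τ T L : ℝ} {a w₀ : ℝ → ℝ} {A α H γ : ℝ≥0}
    (D : SpatialDomain) (ha : IsSpeed lo up a) (haH : HolderWith A α a)
    (hwH : HolderWith H γ w₀) (hα0 : 0 < α) (hα1 : α ≤ 1) (hγ0 : 0 < γ) (hγ1 : γ ≤ 1)
    (hL : 0 < L) (hD : D.Admissible L a w₀) (hh : 0 < h) (hθ : 0 < θ)
    (hcfl : θ * up ≤ 1) (hτ : 0 ≤ τ) (hτT : τ ≤ T) {x : ℝ} (hx : x ∈ D.toSet L) :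
    |w₀ (charFoot a τ x) - upwindApprox a w₀ (θ * h) h τ x|
      ≤ D.errorConst lo up A H γ T L * h ^ upwindRate α γ / (1 + |x|) := by
  cases D with
  | periodic =>
    exact abs_error_le_of_periodic ha haH hwH hα0 hα1 hγ0 hγ1 hL hD.2 hh hθ hcfl hτ hτT hx
  | line => exact abs_error_le_of_line ha haH hwH hα0 hα1 hγ0 hγ1 hL hD hh hθ hcfl hτ hτT x

theorem SpatialDomain.measurableSet_toSet (D : SpatialDomain) (L : ℝ) :
    MeasurableSet (D.toSet L) := by
  cases D with
  | periodic => exact measurableSet_Ico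
  | line => exact MeasurableSet.univ

theorem SpatialDomain.pos_of_mem_meshSizes {D : SpatialDomain} {L h : ℝ}
    (hh : h ∈ D.meshSizes L) : 0 < h := by
  cases D with
  | periodic => exact hh.1
  | line => exact hh

/-- Error estimate in `L²`. -/
theorem SpatialDomain.eLpNorm_error_le {lo up θ h τ T L : ℝ} {a w₀ : ℝ → ℝ} {A α H γ : ℝ≥0}
    (D : SpatialDomain) (ha : IsSpeed lo up a) (haH : HolderWith A α a)
    (hwH : HolderWith H γ w₀) (hα0 : 0 < α) (hα1 : α ≤ 1) (hγ0 : 0 < γ) (hγ1 : γ ≤ 1)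
    (hL : 0 < L) (hD : D.Admissible L a w₀) (hh : 0 < h) (hθ : 0 < θ)
    (hcfl : θ * up ≤ 1) (hτ : 0 ≤ τ) (hτT : τ ≤ T) :
    eLpNorm (fun x => w₀ (charFoot a τ x) - upwindApprox a w₀ (θ * h) h τ x) 2
        (volume.restrict (D.toSet L))
      ≤ (((D.errorConst lo up A H γ T L).toNNReal
          * (eLpNorm (fun x : ℝ => (1 + |x|)⁻¹) 2 volume).toNNReal : ℝ≥0) : ℝ≥0∞)
        * ENNReal.ofReal (h ^ upwindRate α γ) := by
  set E := (D.errorConst lo up A H γ T L).toNNReal with hE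
  have h1 : eLpNorm (fun x => w₀ (charFoot a τ x) - upwindApprox a w₀ (θ * h) h τ x) 2
        (volume.restrict (D.toSet L))
      ≤ eLpNorm (fun x : ℝ => (E * h ^ upwindRate α γ) * (1 + |x|)⁻¹) 2
        (volume.restrict (D.toSet L)) := by
    refine eLpNorm_mono_ae_real (ae_restrict_of_forall_mem (D.measurableSet_toSet L)
      fun x hx => ?_)
    rw [← div_eq_mul_inv]
    refine (D.abs_error_le ha haH hwH hα0 hα1 hγ0 hγ1 hL hD hh hθ hcfl hτ hτT hx).trans ?_
    gcongr
    exact Real.le_coe_toNNReal _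
  refine h1.trans ((eLpNorm_mono_measure _ Measure.restrict_le_self).trans_eq ?_)
  rw [ENNReal.coe_mul, ENNReal.coe_toNNReal eLpNorm_inv_one_add_abs_lt_top.ne]
  have := eLpNorm_const_smul (E * h ^ upwindRate α γ) (fun x : ℝ => (1 + |x|)⁻¹) 2 volume
  simp only [Pi.smul_def, smul_eq_mul] at this
  rw [this, Real.enorm_eq_ofReal (by positivity), ENNReal.ofReal_mul E.coe_nonneg,
    ENNReal.ofReal_coe_nnreal]
  ring

theorem theorem2p6 (D : SpatialDomain) (L T aLow aUp : ℝ) (α γ A H : ℝ≥0)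
    (hL : 0 < L) (hT : 0 < T) (haLow : 0 < aLow)
    (hα0 : 0 < α) (hα1 : α ≤ 1) (hγ0 : 0 < γ) (hγ1 : γ ≤ 1) :
    ∃ C : ℝ≥0, ∀ ρ a w₀ : ℝ → ℝ, IsMollifier ρ →
      (∀ x, aLow ≤ a x ∧ a x ≤ aUp) → HolderWith A α a → HolderWith H γ w₀ →
      D.Admissible L a w₀ →
      (∃ w : ℝ → ℝ → ℝ, IsRegularizationLimit ρ a w₀ T w) ∧
      ∀ w : ℝ → ℝ → ℝ, IsRegularizationLimit ρ a w₀ T w →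
        IsWeakSolution a w₀ T w ∧
        ∀ θ : ℝ, 0 < θ → θ * aUp ≤ 1 → ∀ τ ∈ Ioo 0 T,
          (∀ Δx ∈ D.meshSizes L,
            eLpNorm (fun x => w τ x - upwindApprox a w₀ (θ * Δx) Δx τ x) 2
                (volume.restrict (D.toSet L)) ≤
              C * ENNReal.ofReal
                  (Δx ^ (((γ : ℝ) * (α : ℝ)) / ((γ : ℝ) * (α : ℝ) + 2 - (γ : ℝ)))) +
                C * eLpNorm (fun x => w₀ x - upwindApprox a w₀ (θ * Δx) Δx 0 x) 2
                  (volume.restrict (D.toSet L))) ∧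
          Tendsto (fun Δx => eLpNorm (fun x => w τ x - upwindApprox a w₀ (θ * Δx) Δx τ x) 2
              (volume.restrict (D.toSet L))) (𝓝[D.meshSizes L] 0) (𝓝 0) := by
  refine ⟨(D.errorConst aLow aUp A H γ T L).toNNReal
    * (eLpNorm (fun x : ℝ => (1 + |x|)⁻¹) 2 volume).toNNReal, ?_⟩
  intro ρ a w₀ hρ hab haH hwH hD
  have ha : IsSpeed aLow aUp a :=
    ⟨haLow, haH.continuous hα0, fun x => (hab x).1, fun x => (hab x).2⟩
  refine ⟨⟨_, isRegularizationLimit_charFoot hρ ha haH hα0 hwH hγ0⟩, fun w hw => ?_⟩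
  have hsol : ∀ t ∈ Icc 0 T, ∀ x, w t x = w₀ (charFoot a t x) := fun t ht x =>
    hw.eq_charFoot hρ ha haH hα0 hwH hγ0 ht x
  refine ⟨ha.isWeakSolution hwH hγ0 hsol, fun θ hθ hcfl τ hτ => ?_⟩
  simp only [hsol τ (Ioo_subset_Icc_self hτ)]
  have est := fun Δx (hΔx : Δx ∈ D.meshSizes L) =>
    D.eLpNorm_error_le ha haH hwH hα0 hα1 hγ0 hγ1 hL hD (SpatialDomain.pos_of_mem_meshSizes hΔx) hθ hcfl
      hτ.1.le hτ.2.le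
  -- The rate term alone bounds the error, so the initial error is added for free and convergence
  -- follows from the same estimate.
  refine ⟨fun Δx hΔx => (est Δx hΔx).trans le_self_add, ?_⟩
  have hrate := upwindRate_pos hα0 hγ0 hγ1
  have hlim : Tendsto (fun Δx : ℝ => ENNReal.ofReal (Δx ^ upwindRate α γ)) (𝓝[D.meshSizes L] 0)
      (𝓝 0) := by
    have h1 := (Real.continuousAt_rpow_const 0 (upwindRate α γ) (Or.inr hrate.le)).tendsto
    rw [Real.zero_rpow hrate.ne'] at h1
    simpa using ENNReal.tendsto_ofReal (h1.mono_left (nhdsWithin_le_nhds (s := D.meshSizes L)))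
  have hzero := ENNReal.Tendsto.const_mul hlim (Or.inr (ENNReal.coe_ne_top (r :=
    (D.errorConst aLow aUp A H γ T L).toNNReal
      * (eLpNorm (fun x : ℝ => (1 + |x|)⁻¹) 2 volume).toNNReal)))
  rw [mul_zero] at hzero
  exact tendsto_of_tendsto_of_tendsto_of_le_of_le' tendsto_const_nhds hzero
    (Eventually.of_forall fun _ => zero_le) (eventually_mem_nhdsWithin.mono est)
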